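/- **Games.** A binary game is a function $\lambda:\{0,1\}\times[0,1]\to[0,\infty]$ (outcome, prediction $\mapsto$ loss). It is *regular* if for each bit $b$ the function $\lambda(b,\cdot)$ is convex and continuous, some $\gamma\in[0,1]$ has $\lambda(0,\gamma),\lambda(1,\gamma)<\infty$, and whenever $\lambda(b,\gamma)=\infty$ there are $\gamma_n\to\gamma$ with $\lambda(b,\gamma_n)<\infty$ for all $n$. **Entropy.** A strategy $\wp$ assigns a prediction to every finite binary string, and $\mathrm{Loss}(w,\wp)=\sum_{i<|w|}\lambda(w_i,\wp(w_0\dots w_{i-1}))$. Let $P$ be a Borel probability measure on $\{0,1\}^{\mathbb N}$ that is invariant and ergodic under the left shift. Put $H_n=\inf_{\wp}\sum_{w\in\{0,1\}^n}P(w)\,\mathrm{Loss}(w,\wp)$, where $P(w)$ is the probability of the cylinder of $w$ and $0\cdot\infty=0$. The generalized entropy is $H=\lim_{n\to\infty}H_n/n$. **Strong regularity (with respect to $P$).** Let $\hat P$ be the two-sided extension of $P$, that is, the shift-invariant measure on $\{0,1\}^{\mathbb Z}$ whose coordinates $0,1,2,\dots$ have joint law $P$. The game is strongly regular if it is regular and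 there is a continuous $s:[0,1]\to[0,1]$ such that $s(p)$ minimizes $\gamma\mapsto p\,\lambda(0,\gamma)+(1-p)\,\lambda(1,\gamma)$ for every $p\in[0,1]$ and, with $$g_k(\omega)=\lambda\bigl(\omega_0,s(\hat P\{\omega_0=0\mid\omega_{-k},\dots,\omega_{-1}\})\bigr),\qquad g(\omega)=\lambda\bigl(\omega_0,s(\hat P\{\omega_0=0\mid\omega_i,\ i<0\})\bigr),$$ the functions $G_N=\sup_{k\ge N}|g_k-g|$, $N\ge1$, are uniformly integrable: $\sup_{N\ge1}\int_{\{G_N>\alpha\}}G_N\,d\hat P\to0$ as $\alpha\to\infty$. **Predictive complexity.** A superscore is a pair $(s_0,s_1)\in(-\infty,\infty]^2$ for which some $\gamma\in[0,1]$ has $\lambda(0,\gamma)\le s_0$ and $\lambda(1,\gamma)\le s_1$. The game is mixable if for some $\beta\in(0,1)$ the set $\{(\beta^{s_0},\beta^{s_1}):(s_0,s_1)\text{ a superscore}\}$ is convex, where $\beta^\infty=0$. A superloss process is a function $L$ from finite binary strings to $(-\infty,\infty]$ that is $0$ at the empty string, is upper semicomputable (the set of pairs $(x,q)$, $q\in\mathbb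 Q$, with $L(x)<q$ is recursively enumerable), and for every string $x$ satisfies $L(x0)=L(x)+s_0$ and $L(x1)=L(x)+s_1$ for some superscore $(s_0,s_1)$. A predictive complexity of the game is a superloss process $K$ such that for every superloss process $L$ there is a constant $C$ with $K(x)\le L(x)+C$ for all strings $x$. **Theorem.** Let $P$ be a stationary ergodic probability measure on $\{0,1\}^{\mathbb N}$, let $\lambda$ be a mixable game that is strongly regular with respect to $P$, and let $K$ be a predictive complexity of the game. Then the generalized entropy $H=\lim_n H_n/n$ exists and is finite, and $$\lim_{n\to\infty}\frac{K(\omega_0\dots\omega_{n-1})}{n}=H\qquad\text{for }P\text{-almost every }\omega.$$ -/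

import Mathlib

open MeasureTheory ProbabilityTheory Filter Topology
open scoped ENNReal NNReal unitInterval

noncomputable section

/-! Outcomes are bits, `false` being the bit `0` and `true` the bit `1`. A finite string is a
`List Bool` (written in order of time), an infinite sequence of outcomes is a map `ℕ → Bool`. -/

/-- A binary game: predictions are points of `[0,1]`, losses lie in `[0,∞]`. -/
structure Game where
  loss : Bool → I → ℝ≥0∞

/-- The prefix `ω_0 … ω_{n-1}`. -/
def pre (ω : ℕ → Bool) (n : ℕ) : List Bool := List.ofFn fun i : Fin n => ω i

/-- The cylinder of all infinite sequences having `x` as a prefix. -/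
def cylinder (x : List Bool) : Set (ℕ → Bool) := {ω | pre ω x.length = x}

/-- The left shift on one-sided sequences. -/
def shift (ω : ℕ → Bool) : ℕ → Bool := fun n => ω (n + 1)

/-- The left shift on two-sided sequences. -/
def shiftZ (ω : ℤ → Bool) : ℤ → Bool := fun n => ω (n + 1)

/-- `Q` is the natural two-sided extension of `P`: the shift-invariant measure on two-sided
sequences under which the coordinates `0, 1, 2, …` have joint law `P`. -/
structure IsTwoSidedExtension (P : Measure (ℕ → Bool)) (Q : Measure (ℤ → Bool)) : Prop where
  invariant : MeasurePreserving shiftZ Q Q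
  law : Q.map (fun ω (n : ℕ) => ω (n : ℤ)) = P

/-- The conditional probability under `Q` that `ω_0` is the bit `0`, given the coordinates
`ω_i`, `i ∈ S`. The version of the conditional expectation is projected to `[0,1]`, where it lies
almost surely anyway. -/
def condProbZero (Q : Measure (ℤ → Bool)) (S : Set ℤ) (ω : ℤ → Bool) : I :=
  Set.projIcc (0 : ℝ) 1 zero_le_one
    ((Q⟦{ω : ℤ → Bool | ω 0 = false} | MeasurableSpace.comap
      (fun (ω' : ℤ → Bool) (i : S) => ω' i) inferInstance⟧) ω)

/-- Uniform integrability of the sequence `f 1, f 2, …` of nonnegative functions: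
`sup_{n ≥ 1} ∫ f n · 1_{f n > α} dQ → 0` as `α → ∞`. -/
def IsUniformlyIntegrable {Ω : Type*} [MeasurableSpace Ω] (Q : Measure Ω)
    (f : ℕ → Ω → ℝ≥0∞) : Prop :=
  Tendsto (fun α : ℝ≥0 => ⨆ n : ℕ, ⨆ _ : 1 ≤ n, ∫⁻ ω in {ω | (α : ℝ≥0∞) < f n ω}, f n ω ∂Q)
    atTop (𝓝 0)

/-- Upper semicomputability: the set of pairs (string, rational number) such that the value at the
string is smaller than the rational number is recursively enumerable. The triple `(a, b, c)` of
natural numbers codes the rational number `(a - b) / (c + 1)`. -/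
def IsUpperSemicomputable (f : List Bool → EReal) : Prop :=
  REPred fun p : List Bool × ℕ × ℕ × ℕ =>
    f p.1 < ((((p.2.1 : ℝ) - (p.2.2.1 : ℝ)) / ((p.2.2.2 : ℝ) + 1) : ℝ) : EReal)

/-- The map `x ↦ β ^ x` on `(-∞, ∞]`, with `β ^ ∞ = 0` (for `0 < β < 1`). -/
def betaPow (β : ℝ) (x : EReal) : ℝ := if x = ⊤ then 0 else β ^ x.toReal

namespace Game

/-- A strategy `℘` makes, after each finite string of outcomes, a prediction. This is its
cumulative loss `∑_{i < |w|} λ(w_i, ℘(w_0 … w_{i-1}))` on the string `w`. -/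
def cumLoss (G : Game) (s : List Bool → I) (w : List Bool) : ℝ≥0∞ :=
  ∑ i : Fin w.length, G.loss (w.get i) (s (w.take i))

/-- The `n`-step generalized entropy: the infimum over strategies of the expected loss on
strings of length `n`. -/
def nStepEntropy (G : Game) (P : Measure (ℕ → Bool)) (n : ℕ) : ℝ≥0∞ :=
  ⨅ s : List Bool → I, ∑ w : Fin n → Bool,
    P (cylinder (List.ofFn w)) * G.cumLoss s (List.ofFn w)

/-- The generalized entropy `lim H_n / n`. -/
def generalizedEntropy (G : Game) (P : Measure (ℕ → Bool)) : ℝ≥0∞ :=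
  limUnder atTop fun n : ℕ => G.nStepEntropy P n / n

structure IsRegular (G : Game) : Prop where
  /-- Each `λ(b, ·)` is convex (with values in `[0,∞]`). -/
  convex : ∀ (b : Bool) (t x y z : I), (z : ℝ) = t * x + (1 - t) * y →
    G.loss b z ≤ ENNReal.ofReal t * G.loss b x + ENNReal.ofReal (1 - t) * G.loss b y
  continuous : ∀ b : Bool, Continuous (G.loss b)
  exists_finite : ∃ γ : I, ∀ b : Bool, G.loss b γ < ∞
  approx : ∀ (b : Bool) (γ : I), G.loss b γ = ∞ →
    ∃ u : ℕ → I, Tendsto u atTop (𝓝 γ) ∧ ∀ n, G.loss b (u n) < ∞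

/-- Expected loss of the prediction `γ` when the next outcome is `0` with probability `p`. -/
def expLoss (G : Game) (p γ : I) : ℝ≥0∞ :=
  ENNReal.ofReal p * G.loss false γ + ENNReal.ofReal (1 - p) * G.loss true γ

/-- The loss `λ(ω_0, s(P{0 | ω_i, i ∈ S}))` at time `0` of the predictor that applies `s` to the
conditional probability of the bit `0` given the coordinates in `S`. -/
def lossAtZero (G : Game) (s : I → I) (Q : Measure (ℤ → Bool)) (S : Set ℤ) (ω : ℤ → Bool) :
    ℝ≥0∞ :=
  G.loss (ω 0) (s (condProbZero Q S ω))

/-- `G_N = sup_{k ≥ N} |g_k - g|`, where `g_k` is the loss when predicting `ω_0` from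
`ω_{-k}, …, ω_{-1}` and `g` is the loss when predicting `ω_0` from the whole past. The absolute
difference in `[0,∞]` is the maximum of the two truncated differences. -/
def maxDeviation (G : Game) (s : I → I) (Q : Measure (ℤ → Bool)) (N : ℕ) (ω : ℤ → Bool) :
    ℝ≥0∞ :=
  ⨆ k : ℕ, ⨆ _ : N ≤ k,
    max (G.lossAtZero s Q (Set.Ico (-(k : ℤ)) 0) ω - G.lossAtZero s Q (Set.Iio 0) ω)
      (G.lossAtZero s Q (Set.Iio 0) ω - G.lossAtZero s Q (Set.Ico (-(k : ℤ)) 0) ω)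

/-- Strong regularity with respect to the stationary measure `P`: the game is regular, an optimal
prediction `s p` can be chosen as a continuous function of the (conditional) probability `p` of
the bit `0`, and the resulting sequence `G_1, G_2, …` is uniformly integrable. -/
def IsStronglyRegular (G : Game) (P : Measure (ℕ → Bool)) : Prop :=
  G.IsRegular ∧
  ∃ s : I → I, Continuous s ∧ (∀ p γ : I, G.expLoss p (s p) ≤ G.expLoss p γ) ∧
    ∃ Q : Measure (ℤ → Bool), IsTwoSidedExtension P Q ∧
      IsUniformlyIntegrable Q (G.maxDeviation s Q)

/-- The set of superscores, a subset of `(-∞,∞]²`. -/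
def superscores (G : Game) : Set (EReal × EReal) :=
  {p | p.1 ≠ ⊥ ∧ p.2 ≠ ⊥ ∧
    ∃ γ : I, (G.loss false γ : EReal) ≤ p.1 ∧ (G.loss true γ : EReal) ≤ p.2}

/-- Mixability: for some `β ∈ (0,1)`, the image of the set of superscores under
`(x, y) ↦ (β ^ x, β ^ y)` is convex. -/
def IsMixable (G : Game) : Prop :=
  ∃ β : ℝ, 0 < β ∧ β < 1 ∧
    Convex ℝ ((fun p : EReal × EReal => (betaPow β p.1, betaPow β p.2)) '' G.superscores)

/-- Superloss processes. That the pair of increments of `L` at `x` is a superscore is written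
without subtraction, because `L x` may be `∞` (and then `L` is `∞` at all extensions of `x`). -/
structure IsSuperloss (G : Game) (L : List Bool → EReal) : Prop where
  ne_bot : ∀ x, L x ≠ ⊥
  nil : L [] = 0
  increments : ∀ x, ∃ p ∈ G.superscores,
    L (x ++ [false]) = L x + p.1 ∧ L (x ++ [true]) = L x + p.2
  upperSemicomputable : IsUpperSemicomputable L

/-- `K` is a predictive complexity of the game: a superloss process that is minimal up to an
additive constant. -/
def IsPredictiveComplexity (G : Game) (K : List Bool → EReal) : Prop :=
  G.IsSuperloss K ∧
  ∀ L : List Bool → EReal, G.IsSuperloss L → ∃ C : ℝ, ∀ x, K x ≤ L x + (C : EReal)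

end Game

end

/-! Let h_k be the least expected loss at the step that follows k observed outcomes
(`Game.stepEntropy`). Predictions after different strings are chosen independently, so H_n = h_0 + …
+ h_{n-1}. By stationarity a longer past can only help, so h_k decreases to a limit h, finite
because some prediction has finite losses, and H_n/n → h by Cesàro.

Upper bound (`Game.IsPredictiveComplexity.ae_eventually_div_le`): a nearly optimal predictor that
sees only the last k outcomes, with its losses rounded up to rationals, is run by a finite
automaton. Its cumulative cost is therefore a superloss process, K exceeds it by at most a constant,
and Birkhoff's theorem gives its growth rate, which is close to h_k.

Lower bound (`Game.IsSuperloss.ae_eventually_le_div`): the two-sided extension Q is again ergodic.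
There K competes with the predictor s(p), where p is the conditional probability given the whole
past; let g be its loss at time 0 and T the shift. By mixability and the optimality of s(p), the
ratio of β^(increment of K) to β^(loss of s(p)) has conditional mean at most 1
(`Game.mean_betaPow_div_le_one`). So β^(K - ∑ g∘T^i) has mean at most 1 and is almost surely at most
(n+1)^2 for large n, which gives K ≥ ∑ g∘T^i - O(log n). Birkhoff's theorem under Q turns the sum
into n∫g.

Finally ∫g ≥ h (`Game.IsRegular.iInf_stepEntropy_le`): the conditional probabilities given finite
pasts converge, the minimal expected loss is upper semicontinuous in p and bounded, and the reverse
Fatou lemma applies. -/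

/-! ### Birkhoff's ergodic theorem, by a maximal inequality. -/

section Birkhoff

variable {α : Type*} {T : α → α}

/-- The maximum of the Birkhoff sums of `f` of lengths `1, …, n + 1`. -/
noncomputable def maxBirkhoffSum (T : α → α) (f : α → ℝ) : ℕ → α → ℝ
  | 0 => f
  | n + 1 => fun x => f x + max 0 (maxBirkhoffSum T f n (T x))

theorem maxBirkhoffSum_mono (f : α → ℝ) (n : ℕ) (x : α) :
    maxBirkhoffSum T f n x ≤ maxBirkhoffSum T f (n + 1) x := by
  induction n generalizing x with
  | zero => simp [maxBirkhoffSum]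
  | succ n ih =>
    have := max_le_max (le_refl (0 : ℝ)) (ih (T x))
    simp only [maxBirkhoffSum] at this ⊢
    linarith

theorem le_maxBirkhoffSum (f : α → ℝ) (n : ℕ) (x : α) : f x ≤ maxBirkhoffSum T f n x := by
  cases n with
  | zero => simp [maxBirkhoffSum]
  | succ n => simp [maxBirkhoffSum]

theorem birkhoffSum_le_maxBirkhoffSum (f : α → ℝ) (n : ℕ) (x : α) :
    birkhoffSum T f (n + 1) x ≤ maxBirkhoffSum T f n x := by
  induction n generalizing x with
  | zero => simp [maxBirkhoffSum]
  | succ n ih =>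
    rw [birkhoffSum_succ']
    have := (ih (T x)).trans (le_max_right 0 _)
    simp only [maxBirkhoffSum]
    linarith

variable [MeasurableSpace α] {μ : Measure α}

theorem measurable_maxBirkhoffSum (hT : Measurable T) {f : α → ℝ} (hf : Measurable f) (n : ℕ) :
    Measurable (maxBirkhoffSum T f n) := by
  induction n with
  | zero => exact hf
  | succ n ih => exact hf.add (measurable_const.max (ih.comp hT))

theorem integrable_maxBirkhoffSum (hT : MeasurePreserving T μ μ) {f : α → ℝ}
    (hf : Integrable f μ) (n : ℕ) : Integrable (maxBirkhoffSum T f n) μ := by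
  induction n with
  | zero => exact hf
  | succ n ih =>
    have h := (hT.integrable_comp_of_integrable ih).pos_part
    refine (hf.add h).congr (ae_of_all _ fun x => ?_)
    simp [maxBirkhoffSum, max_comm]

/-- The Birkhoff sums of a function with negative mean are almost surely bounded above. -/
theorem ae_birkhoffSum_bddAbove (hT : Ergodic T μ) {f : α → ℝ}
    (hm : Measurable f) (hf : Integrable f μ) (hneg : ∫ x, f x ∂μ < 0) :
    ∀ᵐ x ∂μ, ∃ C : ℝ, ∀ n, birkhoffSum T f n x ≤ C := by
  set F := maxBirkhoffSum T f
  have hFm : ∀ n, Measurable (F n) := measurable_maxBirkhoffSum hT.measurable hm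
  have hFi : ∀ n, Integrable (F n) μ := integrable_maxBirkhoffSum hT.toMeasurePreserving hf
  set A : Set α := {x | ∀ C : ℕ, ∃ n, (C : ℝ) < F n x} with hA
  have hAm : MeasurableSet A := by
    have : A = ⋂ C : ℕ, ⋃ n, {x | (C : ℝ) < F n x} := by ext; simp [hA]
    rw [this]
    exact .iInter fun C => .iUnion fun n => measurableSet_lt measurable_const (hFm n)
  -- The recursion gives sup F(x) = f x + max(0, sup F(T x)), so the suprema at x and T x are
  -- infinite together.
  have hinv : T ⁻¹' A = A := by
    ext x
    simp only [hA, Set.mem_preimage, Set.mem_ofPred_eq]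
    constructor
    · intro h C
      obtain ⟨D, hD⟩ := exists_nat_gt ((C : ℝ) - f x)
      obtain ⟨n, hn⟩ := h D
      refine ⟨n + 1, ?_⟩
      have := le_max_right 0 (F n (T x))
      simp only [F, maxBirkhoffSum] at this hn ⊢
      linarith
    · intro h C
      obtain ⟨D, hD⟩ := exists_nat_gt ((C : ℝ) + |f x|)
      obtain ⟨n, hn⟩ := h D
      refine ⟨n, ?_⟩
      have h1 := hn.trans_le (maxBirkhoffSum_mono f n x)
      have h2 := le_abs_self (f x)
      simp only [maxBirkhoffSum] at h1
      rcases le_total (maxBirkhoffSum T f n (T x)) 0 with h3 | h3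
      · rw [max_eq_left h3] at h1
        have : (0 : ℝ) ≤ C := Nat.cast_nonneg C
        linarith
      · rw [max_eq_right h3] at h1
        simp only [F]
        linarith
  -- By invariance of μ, integrating F_{n+1} = f + (F_n ∘ T)⁺ gives ∫F_n ≤ ∫F_{n+1} = ∫f + ∫F_n⁺;
  -- subtract ∫F_n.
  have hstep (n : ℕ) : 0 ≤ ∫ x, f x ∂μ + ∫ x, max (-F n x) 0 ∂μ := by
    have hc : Integrable (fun x => max (F n (T x)) 0) μ :=
      (hT.toMeasurePreserving.integrable_comp_of_integrable (hFi n)).pos_part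
    have hc' : ∫ x, max (F n (T x)) 0 ∂μ = ∫ x, max (F n x) 0 ∂μ := by
      have h0 := integral_map (μ := μ) hT.measurable.aemeasurable
        (f := fun x => max (F n x) 0) ((hFm n).max measurable_const).aestronglyMeasurable
      rw [hT.toMeasurePreserving.map_eq] at h0
      exact h0.symm
    have h1 : ∫ x, F n x ∂μ ≤ ∫ x, F (n + 1) x ∂μ :=
      integral_mono (hFi n) (hFi (n + 1)) fun x => maxBirkhoffSum_mono f n x
    have h2 : ∫ x, F (n + 1) x ∂μ = ∫ x, f x ∂μ + ∫ x, max (F n x) 0 ∂μ := by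
      rw [← hc', ← integral_add hf hc]
      simp only [F, maxBirkhoffSum, max_comm]
    have h3 : ∫ x, F n x ∂μ = ∫ x, max (F n x) 0 ∂μ - ∫ x, max (-F n x) 0 ∂μ := by
      rw [← integral_sub (hFi n).pos_part (hFi n).neg_part]
      refine integral_congr_ae (ae_of_all _ fun x => ?_)
      rcases le_total (F n x) 0 with h | h <;> simp [h]
    linarith
  have hnull : ¬ ∀ᵐ x ∂μ, x ∈ A := by
    intro hae
    -- On A the F_n are eventually positive, and f ≤ F_n bounds the negative parts by |f|. In the
    -- limit `hstep` then yields 0 ≤ ∫f, a contradiction.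
    have hlim : Tendsto (fun n => ∫ x, max (-F n x) 0 ∂μ) atTop (𝓝 (∫ _, (0 : ℝ) ∂μ)) := by
      refine tendsto_integral_of_dominated_convergence (fun x => |f x|)
        (fun n => ((hFm n).neg.max measurable_const).aestronglyMeasurable) hf.abs
        (fun n => ae_of_all _ fun x => ?_) ?_
      · have h1 := le_maxBirkhoffSum (T := T) f n x
        have h2 := neg_le_abs (f x)
        rw [Real.norm_of_nonneg (le_max_right _ _)]
        refine max_le ?_ (abs_nonneg _)
        simp only [F]
        linarith
      · filter_upwards [hae] with x hx
        obtain ⟨N, hN⟩ := hx 0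
        refine tendsto_const_nhds.congr' ?_
        filter_upwards [eventually_ge_atTop N] with n hn
        have hmono : Monotone fun n => F n x := monotone_nat_of_le_succ fun n =>
          maxBirkhoffSum_mono f n x
        have : F N x ≤ F n x := hmono hn
        rw [Nat.cast_zero] at hN
        exact (max_eq_right (by linarith)).symm
    have := ge_of_tendsto' (tendsto_const_nhds.add hlim) hstep
    simp only [integral_zero, add_zero] at this
    linarith
  have hconst := hT.ae_mem_or_ae_notMem hAm hinv
  filter_upwards [hconst.resolve_left hnull] with x hx
  simp only [hA, Set.mem_ofPred_eq, not_forall, not_exists, not_lt] at hx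
  obtain ⟨C, hC⟩ := hx
  refine ⟨C, fun n => ?_⟩
  cases n with
  | zero => simp
  | succ n => exact (birkhoffSum_le_maxBirkhoffSum f n x).trans (hC n)

/-- For d strictly between the mean and c, the sums of f - d are bounded by some C, so the sums of f
are at most C + nd, which is below nc once n > C/(c - d). -/
theorem ae_eventually_birkhoffSum_div_le (hT : Ergodic T μ) [IsProbabilityMeasure μ] {f : α → ℝ}
    (hm : Measurable f) (hf : Integrable f μ) {c : ℝ} (hc : ∫ x, f x ∂μ < c) :
    ∀ᵐ x ∂μ, ∀ᶠ n : ℕ in atTop, birkhoffSum T f n x / n < c := by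
  obtain ⟨d, hd, hdc⟩ := exists_between hc
  have h := ae_birkhoffSum_bddAbove hT (f := fun x => f x - d) (hm.sub measurable_const)
    (hf.sub (integrable_const d)) (by
      rw [integral_sub hf (integrable_const d)]; simpa using hd)
  filter_upwards [h] with x ⟨C, hC⟩
  obtain ⟨N, hN⟩ := exists_nat_gt (C / (c - d))
  filter_upwards [eventually_ge_atTop (N + 1)] with n hn
  have hn0 : (0 : ℝ) < n := by exact_mod_cast (Nat.succ_pos N).trans_le hn
  have hNn : (N : ℝ) ≤ n := by exact_mod_cast (Nat.le_succ N).trans hn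
  have h1 := hC n
  have h2 : birkhoffSum T (fun x => f x - d) n x = birkhoffSum T f n x - n * d := by
    simp [birkhoffSum, Finset.sum_sub_distrib]
  rw [h2] at h1
  rw [div_lt_iff₀ hn0]
  rw [div_lt_iff₀ (by linarith)] at hN
  have : (N : ℝ) * (c - d) ≤ n * (c - d) := by gcongr
  nlinarith

/-- **Birkhoff's pointwise ergodic theorem** for an ergodic transformation. -/
theorem ae_tendsto_birkhoffSum_div (hT : Ergodic T μ) [IsProbabilityMeasure μ] {f : α → ℝ}
    (hm : Measurable f) (hf : Integrable f μ) :
    ∀ᵐ x ∂μ, Tendsto (fun n : ℕ => birkhoffSum T f n x / n) atTop (𝓝 (∫ x, f x ∂μ)) := by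
  have h1 (j : ℕ) := ae_eventually_birkhoffSum_div_le hT hm hf
    (c := ∫ x, f x ∂μ + 1 / ((j : ℝ) + 1)) (by linarith [Nat.one_div_pos_of_nat (α := ℝ) (n := j)])
  have h2 (j : ℕ) := ae_eventually_birkhoffSum_div_le hT hm.neg hf.neg
    (c := -∫ x, f x ∂μ + 1 / ((j : ℝ) + 1)) (by
      have := Nat.one_div_pos_of_nat (α := ℝ) (n := j)
      simp only [Pi.neg_apply, integral_neg]
      linarith)
  filter_upwards [ae_all_iff.2 h1, ae_all_iff.2 h2] with x hx1 hx2
  rw [Metric.tendsto_nhds]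
  intro ε hε
  obtain ⟨j, hj⟩ := exists_nat_one_div_lt hε
  filter_upwards [hx1 j, hx2 j] with n hn1 hn2
  have h3 : birkhoffSum T (-f) n x = -birkhoffSum T f n x := by simp [birkhoffSum]
  rw [h3, neg_div] at hn2
  rw [Real.dist_eq, abs_lt]
  constructor <;> linarith

end Birkhoff

/-! ### Prefixes and cylinders. -/

section Cylinders

@[simp] theorem length_pre (ω : ℕ → Bool) (n : ℕ) : (pre ω n).length = n := by simp [pre]

theorem pre_succ (ω : ℕ → Bool) (n : ℕ) : pre ω (n + 1) = pre ω n ++ [ω n] := by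
  rw [pre, List.ofFn_succ']
  simp [pre]

theorem pre_succ' (ω : ℕ → Bool) (n : ℕ) : pre ω (n + 1) = ω 0 :: pre (shift ω) n := by
  simp [pre, List.ofFn_succ, shift]

theorem measurable_shift : Measurable shift :=
  measurable_pi_lambda _ fun n => measurable_pi_apply (n + 1)

/-- Every function of a prefix is measurable. -/
theorem measurable_comp_pre {β : Type*} [MeasurableSpace β] (φ : List Bool → β) (n : ℕ) :
    Measurable fun ω => φ (pre ω n) := by
  have h : Measurable fun w : Fin n → Bool => φ (List.ofFn w) := measurable_of_finite _
  exact h.comp (measurable_pi_lambda _ fun i => measurable_pi_apply (i : ℕ))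

theorem mem_wordCylinder {x : List Bool} {ω : ℕ → Bool} :
    ω ∈ _root_.cylinder x ↔ pre ω x.length = x := Iff.rfl

theorem measurableSet_wordCylinder (x : List Bool) : MeasurableSet (_root_.cylinder x) :=
  measurableSet_setOfPred.2 (measurable_comp_pre (fun y => y = x) x.length)

theorem cylinder_eq_union_append (x : List Bool) :
    _root_.cylinder x = _root_.cylinder (x ++ [false]) ∪ _root_.cylinder (x ++ [true]) := by
  ext ω
  simp only [Set.mem_union, mem_wordCylinder, List.length_append, List.length_cons, List.length_nil,
    zero_add, pre_succ]
  cases ω x.length <;> simp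

theorem preimage_shift_cylinder (x : List Bool) :
    shift ⁻¹' _root_.cylinder x = _root_.cylinder (false :: x) ∪ _root_.cylinder (true :: x) := by
  ext ω
  simp only [Set.mem_preimage, Set.mem_union, mem_wordCylinder, List.length_cons, pre_succ',
    List.cons.injEq]
  cases ω 0 <;> simp

variable (P : Measure (ℕ → Bool))

theorem measure_cylinder_append (x : List Bool) :
    P (_root_.cylinder x) = P (_root_.cylinder (x ++ [false]))
      + P (_root_.cylinder (x ++ [true])) := by
  rw [cylinder_eq_union_append x, measure_union _ (measurableSet_wordCylinder _)]
  rw [Set.disjoint_left]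
  intro ω h0 h1
  simp only [mem_wordCylinder, List.length_append, List.length_cons, List.length_nil] at h0 h1
  simp [h0] at h1

theorem measure_cylinder_cons {P : Measure (ℕ → Bool)} (hP : MeasurePreserving shift P P)
    (x : List Bool) :
    P (_root_.cylinder x) = P (_root_.cylinder (false :: x)) + P (_root_.cylinder (true :: x)) := by
  rw [← hP.measure_preimage (measurableSet_wordCylinder x).nullMeasurableSet,
    preimage_shift_cylinder x, measure_union _ (measurableSet_wordCylinder _)]
  rw [Set.disjoint_left]
  intro ω h0 h1
  simp only [mem_wordCylinder, List.length_cons] at h0 h1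
  simp [h0] at h1

theorem sum_ofFn_append {M : Type*} [AddCommMonoid M] (n : ℕ) (φ : List Bool → M) :
    ∑ w : Fin (n + 1) → Bool, φ (List.ofFn w)
      = ∑ w : Fin n → Bool, ∑ b : Bool, φ (List.ofFn w ++ [b]) := by
  rw [← (Fin.snocEquiv fun _ => Bool).sum_comp, Fintype.sum_prod_type_right]
  refine Finset.sum_congr rfl fun w _ => Finset.sum_congr rfl fun b _ => ?_
  rw [List.ofFn_succ']
  simp [Fin.snocEquiv]

theorem sum_ofFn_cons {M : Type*} [AddCommMonoid M] (n : ℕ) (φ : List Bool → M) :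
    ∑ w : Fin (n + 1) → Bool, φ (List.ofFn w)
      = ∑ w : Fin n → Bool, ∑ b : Bool, φ (b :: List.ofFn w) := by
  rw [← (Fin.consEquiv fun _ => Bool).sum_comp, Fintype.sum_prod_type_right]
  refine Finset.sum_congr rfl fun w _ => Finset.sum_congr rfl fun b _ => ?_
  simp [Fin.consEquiv]

end Cylinders

/-! ### The entropy as the limit of the one-step entropies. -/

namespace Game

section StepEntropy

variable (G : Game) (P : Measure (ℕ → Bool))

theorem cumLoss_nil (s : List Bool → I) : G.cumLoss s [] = 0 := by simp [cumLoss]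

theorem cumLoss_eq_sum_range (s : List Bool → I) (w : List Bool) :
    G.cumLoss s w = ∑ i ∈ Finset.range w.length, G.loss (w.getD i false) (s (w.take i)) := by
  rw [cumLoss, Finset.sum_range]
  simp

theorem cumLoss_append (s : List Bool → I) (w : List Bool) (b : Bool) :
    G.cumLoss s (w ++ [b]) = G.cumLoss s w + G.loss b (s w) := by
  rw [cumLoss_eq_sum_range, cumLoss_eq_sum_range, List.length_append, List.length_singleton,
    Finset.sum_range_succ]
  congr 1
  · refine Finset.sum_congr rfl fun i hi => ?_
    rw [Finset.mem_range] at hi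
    rw [List.getD_append _ _ _ _ hi, List.take_append_of_le_length hi.le]
  · simp

/-- The loss expected at the step following the string `x` (on the event that `x` occurs) when
the prediction is `γ`. -/
noncomputable def wordLoss (x : List Bool) (γ : I) : ℝ≥0∞ :=
  P (_root_.cylinder (x ++ [false])) * G.loss false γ
    + P (_root_.cylinder (x ++ [true])) * G.loss true γ

/-- The optimal expected loss when predicting the outcome that follows `k` given ones. -/
noncomputable def stepEntropy (k : ℕ) : ℝ≥0∞ :=
  ∑ u : Fin k → Bool, ⨅ γ, G.wordLoss P (List.ofFn u) γ

/-- The loss at step k depends only on the first k + 1 outcomes; the later ones are summed out. -/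
theorem sum_cumLoss_eq (s : List Bool → I) (n : ℕ) :
    ∑ w : Fin n → Bool, P (_root_.cylinder (List.ofFn w)) * G.cumLoss s (List.ofFn w)
      = ∑ k ∈ Finset.range n, ∑ u : Fin k → Bool, G.wordLoss P (List.ofFn u) (s (List.ofFn u)) := by
  induction n with
  | zero => simp [cumLoss_nil]
  | succ n ih =>
    rw [sum_ofFn_append n fun x => P (_root_.cylinder x) * G.cumLoss s x, Finset.sum_range_succ,
      ← ih, ← Finset.sum_add_distrib]
    refine Finset.sum_congr rfl fun w _ => ?_
    rw [measure_cylinder_append P (List.ofFn w), Fintype.sum_bool, cumLoss_append, cumLoss_append,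
      wordLoss]
    ring

variable {G P}

theorem IsRegular.exists_wordLoss_le (hG : G.IsRegular) [IsFiniteMeasure P] (x : List Bool) :
    ∃ γ, ∀ γ', G.wordLoss P x γ ≤ G.wordLoss P x γ' := by
  have hc : Continuous (G.wordLoss P x) :=
    ((ENNReal.continuous_const_mul (measure_ne_top P _)).comp (hG.continuous false)).add
      ((ENNReal.continuous_const_mul (measure_ne_top P _)).comp (hG.continuous true))
  obtain ⟨γ, -, hγ⟩ := isCompact_univ.exists_isMinOn Set.univ_nonempty hc.continuousOn
  exact ⟨γ, fun γ' => hγ (Set.mem_univ γ')⟩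

/-- A strategy may minimize separately after each string, and compactness of [0,1] provides a
minimizer for every string at once. -/
theorem nStepEntropy_eq_sum (hG : G.IsRegular) [IsFiniteMeasure P] (n : ℕ) :
    G.nStepEntropy P n = ∑ k ∈ Finset.range n, G.stepEntropy P k := by
  apply le_antisymm
  · choose s hs using hG.exists_wordLoss_le (P := P)
    refine (iInf_le _ s).trans ?_
    rw [sum_cumLoss_eq]
    exact Finset.sum_le_sum fun k _ => Finset.sum_le_sum fun u _ => le_iInf (hs _)
  · refine le_iInf fun s => ?_
    rw [sum_cumLoss_eq]
    exact Finset.sum_le_sum fun k _ => Finset.sum_le_sum fun u _ => iInf_le _ _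

theorem wordLoss_eq_cons_add (hP : MeasurePreserving shift P P) (x : List Bool) (γ : I) :
    G.wordLoss P x γ = G.wordLoss P (false :: x) γ + G.wordLoss P (true :: x) γ := by
  simp only [wordLoss, measure_cylinder_cons hP (x ++ [false]),
    measure_cylinder_cons hP (x ++ [true]), List.cons_append]
  ring

/-- A prediction made after u may also be used after both 0u and 1u, whose weights add up to that of
u by stationarity. -/
theorem stepEntropy_antitone (hP : MeasurePreserving shift P P) :
    Antitone (G.stepEntropy P) := by
  refine antitone_nat_of_succ_le fun k => ?_
  rw [stepEntropy, sum_ofFn_cons k fun x => ⨅ γ, G.wordLoss P x γ, stepEntropy]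
  refine Finset.sum_le_sum fun u _ => le_iInf fun γ => ?_
  rw [Fintype.sum_bool, wordLoss_eq_cons_add hP, add_comm]
  exact add_le_add (iInf_le _ _) (iInf_le _ _)

theorem stepEntropy_ne_top (hG : G.IsRegular) [IsFiniteMeasure P] (k : ℕ) :
    G.stepEntropy P k ≠ ∞ := by
  obtain ⟨γ, hγ⟩ := hG.exists_finite
  refine ENNReal.sum_ne_top.2 fun u _ => ne_top_of_le_ne_top ?_ (iInf_le _ γ)
  exact ENNReal.add_ne_top.2 ⟨ENNReal.mul_ne_top (measure_ne_top _ _) (hγ _).ne,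
    ENNReal.mul_ne_top (measure_ne_top _ _) (hγ _).ne⟩

theorem tendsto_nStepEntropy_div (hG : G.IsRegular) (hP : MeasurePreserving shift P P)
    [IsFiniteMeasure P] :
    Tendsto (fun n : ℕ => G.nStepEntropy P n / n) atTop (𝓝 (⨅ k, G.stepEntropy P k)) := by
  have hfin := stepEntropy_ne_top (P := P) hG
  have hinf : ⨅ k, G.stepEntropy P k ≠ ∞ := ne_top_of_le_ne_top (hfin 0) (iInf_le _ 0)
  have h1 := ((ENNReal.tendsto_toReal hinf).comp
    (tendsto_atTop_iInf (stepEntropy_antitone (G := G) hP))).cesaro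
  have h2 := ENNReal.tendsto_ofReal h1
  rw [ENNReal.ofReal_toReal hinf] at h2
  refine h2.congr' ?_
  filter_upwards [eventually_gt_atTop 0] with n hn
  rw [nStepEntropy_eq_sum hG, ← ENNReal.ofReal_toReal (ENNReal.sum_ne_top.2 fun k _ => hfin k),
    ENNReal.toReal_sum fun k _ => hfin k, inv_mul_eq_div,
    ENNReal.ofReal_div_of_pos (by exact_mod_cast hn), ENNReal.ofReal_natCast]
  rfl

theorem generalizedEntropy_eq (hG : G.IsRegular) (hP : MeasurePreserving shift P P)
    [IsFiniteMeasure P] : G.generalizedEntropy P = ⨅ k, G.stepEntropy P k :=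
  (tendsto_nStepEntropy_div hG hP).limUnder_eq

end StepEntropy

end Game

/-! ### Superloss processes computed by finite automata. -/

section Automata

variable {ι : Type*} (step : ι → Bool → ι) (cost : ι → Bool → ℕ) (init : ι)

/-- The final state and the accumulated cost of a finite automaton reading a string. -/
def automatonRun (x : List Bool) : ι × ℕ :=
  x.foldl (fun q b => (step q.1 b, q.2 + cost q.1 b)) (init, 0)

theorem automatonRun_append (x : List Bool) (b : Bool) :
    automatonRun step cost init (x ++ [b]) =
      (step (automatonRun step cost init x).1 b,
        (automatonRun step cost init x).2 + cost (automatonRun step cost init x).1 b) := by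
  simp [automatonRun]

theorem primrec_automatonRun [Primcodable ι] [Finite ι] :
    Primrec (automatonRun step cost init) := by
  have hs : Primrec fun q : ι × Bool => step q.1 q.2 := Primrec.dom_finite _
  have hc : Primrec fun q : ι × Bool => cost q.1 q.2 := Primrec.dom_finite _
  refine Primrec.list_foldl (f := fun x : List Bool => x) (g := fun _ => (init, 0))
    (h := fun _ p => (step p.1.1 p.2, p.1.2 + cost p.1.1 p.2)) Primrec.id (Primrec.const _) ?_
  have h1 : Primrec fun p : List Bool × ((ι × ℕ) × Bool) => (p.2.1.1, p.2.2) :=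
    (Primrec.fst.comp (Primrec.fst.comp Primrec.snd)).pair (Primrec.snd.comp Primrec.snd)
  exact (hs.comp h1).pair (Primrec.nat_add.comp
    (Primrec.snd.comp (Primrec.fst.comp Primrec.snd)) (hc.comp h1))

/-- With integer costs over one fixed denominator, comparison with a rational becomes a primitive
recursive inequality between natural numbers. -/
theorem isUpperSemicomputable_automaton [Primcodable ι] [Finite ι] {D : ℕ} (hD : 0 < D) :
    IsUpperSemicomputable fun x =>
      ((((automatonRun step cost init x).2 : ℝ) / D : ℝ) : EReal) := by
  have hN : Primrec fun p : List Bool × ℕ × ℕ × ℕ => (automatonRun step cost init p.1).2 :=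
    Primrec.snd.comp ((primrec_automatonRun step cost init).comp Primrec.fst)
  have ha : Primrec fun p : List Bool × ℕ × ℕ × ℕ => p.2.1 := Primrec.fst.comp Primrec.snd
  have hb : Primrec fun p : List Bool × ℕ × ℕ × ℕ => p.2.2.1 :=
    Primrec.fst.comp (Primrec.snd.comp Primrec.snd)
  have hc : Primrec fun p : List Bool × ℕ × ℕ × ℕ => p.2.2.2 :=
    Primrec.snd.comp (Primrec.snd.comp Primrec.snd)
  have h : PrimrecPred fun p : List Bool × ℕ × ℕ × ℕ =>
      (automatonRun step cost init p.1).2 * (p.2.2.2 + 1) + p.2.2.1 * D < p.2.1 * D :=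
    Primrec.nat_lt.comp
      (Primrec.nat_add.comp (Primrec.nat_mul.comp hN (Primrec.succ.comp hc))
        (Primrec.nat_mul.comp hb (Primrec.const D)))
      (Primrec.nat_mul.comp ha (Primrec.const D))
  refine h.computablePred.to_re.of_eq fun p => ?_
  have hD' : (0 : ℝ) < D := by exact_mod_cast hD
  rw [EReal.coe_lt_coe_iff, div_lt_div_iff₀ hD' (by positivity), sub_mul, lt_sub_iff_add_lt]
  exact_mod_cast Iff.rfl

theorem Game.isSuperloss_automaton [Primcodable ι] [Finite ι] {D : ℕ} (hD : 0 < D) (G : Game)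
    (h : ∀ q, ∃ γ, ∀ b, (G.loss b γ : EReal) ≤ (((cost q b : ℝ) / D : ℝ) : EReal)) :
    G.IsSuperloss fun x => ((((automatonRun step cost init x).2 : ℝ) / D : ℝ) : EReal) where
  ne_bot x := EReal.coe_ne_bot _
  nil := by simp [automatonRun]
  increments x := by
    obtain ⟨γ, hγ⟩ := h (automatonRun step cost init x).1
    refine ⟨((((cost (automatonRun step cost init x).1 false : ℝ) / D : ℝ) : EReal),
      (((cost (automatonRun step cost init x).1 true : ℝ) / D : ℝ) : EReal)),
      ⟨EReal.coe_ne_bot _, EReal.coe_ne_bot _, γ, hγ false, hγ true⟩, ?_, ?_⟩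
    all_goals
      simp only [automatonRun_append]
      rw [← EReal.coe_add, Nat.cast_add, add_div]
  upperSemicomputable := isUpperSemicomputable_automaton step cost init hD

end Automata

/-! ### Automata that remember the last k outcomes. -/

section Window

/-- Appends a bit to a window of `k` bits and forgets the oldest one. -/
def windowStep (k : ℕ) (u : Fin k → Bool) (b : Bool) (i : Fin k) : Bool :=
  (Fin.snoc u b : Fin (k + 1) → Bool) i.succ

/-- The condition `k ≤ m + i` says that the arbitrary initial content has already left position i;
it also keeps the subtraction from truncating. -/
theorem windowStep_automatonRun (k : ℕ) (cost : (Fin k → Bool) → Bool → ℕ) (init : Fin k → Bool)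
    (ω : ℕ → Bool) (m : ℕ) (i : Fin k) (h : k ≤ m + i) :
    (automatonRun (windowStep k) cost init (pre ω m)).1 i = ω (m + i - k) := by
  induction m generalizing i with
  | zero => omega
  | succ m ih =>
    rw [pre_succ, automatonRun_append]
    simp only [windowStep, Fin.snoc, Fin.val_succ]
    split_ifs with hi
    · have := ih ⟨i + 1, hi⟩ (by simp only; omega)
      simp only at this
      simp only [cast_eq]
      rw [show m + 1 + i - k = m + (i + 1) - k by omega]
      exact this
    · simp only [cast_eq]
      congr 1
      omega

theorem iterate_shift (ω : ℕ → Bool) (n i : ℕ) : shift^[n] ω i = ω (n + i) := by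
  induction n generalizing ω with
  | zero => simp
  | succ n ih => rw [Function.iterate_succ_apply, ih, shift]; congr 1; omega

/-- Once k outcomes have been read the window is full, and each further cost is one fixed function
of the shifted sequence. -/
theorem automatonRun_window_eq_birkhoffSum (k : ℕ) (cost : (Fin k → Bool) → Bool → ℕ)
    (init : Fin k → Bool) (D : ℝ) (ω : ℕ → Bool) (n : ℕ) :
    ((automatonRun (windowStep k) cost init (pre ω (n + k))).2 : ℝ) / D =
      ((automatonRun (windowStep k) cost init (pre ω k)).2 : ℝ) / D +
        birkhoffSum shift (fun ω => (cost (fun i => ω i) (ω k) : ℝ) / D) n ω := by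
  induction n with
  | zero => simp
  | succ n ih =>
    have hw : (automatonRun (windowStep k) cost init (pre ω (n + k))).1
        = fun i : Fin k => shift^[n] ω i := by
      ext i
      rw [windowStep_automatonRun, iterate_shift]
      · congr 1
        omega
      · omega
    rw [birkhoffSum_succ, ← add_assoc, ← ih, add_right_comm n 1 k, pre_succ, automatonRun_append,
      hw, iterate_shift, Nat.cast_add, add_div]

theorem measurable_prefix_next {β : Type*} [MeasurableSpace β] (k : ℕ)
    (h : List Bool → Bool → β) : Measurable fun ω => h (pre ω k) (ω k) := by
  have hπ : Measurable fun ω : ℕ → Bool => ((fun i : Fin k => ω i), ω k) :=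
    Measurable.prodMk (measurable_pi_lambda _ fun i : Fin k => measurable_pi_apply (i : ℕ))
      (measurable_pi_apply k)
  exact (measurable_of_finite fun q : (Fin k → Bool) × Bool => h (List.ofFn q.1) q.2).comp hπ

theorem lintegral_prefix_next (P : Measure (ℕ → Bool)) (k : ℕ)
    (h : List Bool → Bool → ℝ≥0∞) :
    ∫⁻ ω, h (pre ω k) (ω k) ∂P = ∑ u : Fin k → Bool,
      (P (_root_.cylinder (List.ofFn u ++ [false])) * h (List.ofFn u) false
        + P (_root_.cylinder (List.ofFn u ++ [true])) * h (List.ofFn u) true) := by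
  have hπ : Measurable fun ω : ℕ → Bool => ((fun i : Fin k => ω i), ω k) :=
    Measurable.prodMk (measurable_pi_lambda _ fun i : Fin k => measurable_pi_apply (i : ℕ))
      (measurable_pi_apply k)
  have h1 := lintegral_map (μ := P) (f := fun q : (Fin k → Bool) × Bool => h (List.ofFn q.1) q.2)
    (measurable_of_finite _) hπ
  have h2 (u : Fin k → Bool) (b : Bool) :
      P.map (fun ω : ℕ → Bool => ((fun i : Fin k => ω i), ω k)) {(u, b)}
        = P (_root_.cylinder (List.ofFn u ++ [b])) := by
    rw [Measure.map_apply hπ (measurableSet_singleton _)]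
    congr 1
    ext ω
    simp only [Set.mem_preimage, Set.mem_singleton_iff, Prod.mk.injEq, mem_wordCylinder,
      List.length_append, List.length_ofFn, List.length_singleton, pre_succ]
    simp [pre, List.ofFn_inj, funext_iff]
  rw [lintegral_fintype, Fintype.sum_prod_type] at h1
  simp only [pre, ← h1, h2, Fintype.sum_bool, mul_comm, add_comm]

end Window

/-! ### The upper bound for the predictive complexity. -/

namespace Game

variable {G : Game}

/-- Regularity approximates γ by predictions with finite b-loss; continuity of the other loss keeps
it finite and nearly unchanged. -/
theorem IsRegular.exists_finite_le_of_eq_top (hG : G.IsRegular) {b b' : Bool} (hb : b' ≠ b) {γ : I}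
    (h : G.loss b γ = ∞) (h' : G.loss b' γ ≠ ∞) {d ε : ℝ≥0∞} (hd : d ≠ ∞) (hε : ε ≠ 0) :
    ∃ γ', (∀ b, G.loss b γ' ≠ ∞) ∧ d * G.loss b' γ' ≤ d * G.loss b' γ + ε := by
  obtain ⟨u, hu, hfin⟩ := hG.approx b γ h
  have h1 := ((hG.continuous b').tendsto γ).comp hu
  have h2 := ((ENNReal.continuous_const_mul hd).tendsto _).comp h1
  have h3 := h1.eventually (gt_mem_nhds h'.lt_top)
  have h4 := h2.eventually (gt_mem_nhds (ENNReal.lt_add_right (ENNReal.mul_ne_top hd h') hε))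
  obtain ⟨n, hn3, hn4⟩ := (h3.and h4).exists
  refine ⟨u n, fun c => ?_, hn4.le⟩
  by_cases hc : c = b
  · exact hc ▸ (hfin n).ne
  · have : c = b' := by revert hc hb; cases b <;> cases b' <;> cases c <;> simp
    exact this ▸ hn3.ne

/-- Optimal weighted losses are approximated by predictions with finite losses. -/
theorem IsRegular.exists_finite_le (hG : G.IsRegular) {a c ε : ℝ≥0∞} (ha : a ≠ ∞) (hc : c ≠ ∞)
    (hε : ε ≠ 0) (γ : I) :
    ∃ γ', (∀ b, G.loss b γ' ≠ ∞) ∧ a * G.loss false γ' + c * G.loss true γ'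
      ≤ a * G.loss false γ + c * G.loss true γ + ε := by
  obtain ⟨γ₀, hγ₀⟩ := hG.exists_finite
  by_cases htop : a * G.loss false γ + c * G.loss true γ = ∞
  · exact ⟨γ₀, fun b => (hγ₀ b).ne, by simp [htop]⟩
  -- An infinite loss can enter a finite weighted sum only with weight 0.
  have key (d l : ℝ≥0∞) (h : d * l ≠ ∞) (hl : l = ∞) : d = 0 := by
    by_contra h0
    exact h (hl ▸ ENNReal.mul_top h0)
  obtain ⟨ht0, ht1⟩ := ENNReal.add_ne_top.1 htop
  by_cases h0 : G.loss false γ = ∞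
  · have ha0 := key _ _ ht0 h0
    by_cases h1 : G.loss true γ = ∞
    · exact ⟨γ₀, fun b => (hγ₀ b).ne, by simp [ha0, key _ _ ht1 h1]⟩
    · obtain ⟨γ', h2, h3⟩ := hG.exists_finite_le_of_eq_top (b' := true) (by simp) h0 h1 hc hε
      exact ⟨γ', h2, by simpa [ha0] using h3⟩
  · by_cases h1 : G.loss true γ = ∞
    · obtain ⟨γ', h2, h3⟩ := hG.exists_finite_le_of_eq_top (b' := false) (by simp) h1 h0 ha hε
      exact ⟨γ', h2, by simpa [key _ _ ht1 h1] using h3⟩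
    · exact ⟨γ, by simp [h0, h1], le_self_add⟩

variable {P : Measure (ℕ → Bool)} [IsProbabilityMeasure P]

/-- There are rational costs of predicting from windows of length `k` which dominate the losses of
actual predictions and whose mean is nearly optimal. -/
theorem IsRegular.exists_windowCost (hG : G.IsRegular) (k : ℕ) {δ : ℝ} (hδ : 0 < δ) :
    ∃ (D : ℕ) (cost : List Bool → Bool → ℕ), 0 < D ∧
      (∀ u, ∃ γ, ∀ b, (G.loss b γ : EReal) ≤ (((cost u b : ℝ) / D : ℝ) : EReal)) ∧
      ∫⁻ ω, ENNReal.ofReal ((cost (pre ω k) (ω k) : ℝ) / D) ∂P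
        ≤ G.stepEntropy P k + ENNReal.ofReal δ := by
  -- Half of δ pays for rounding losses up to multiples of 1/D; the other half, shared equally among
  -- the 2^k windows, pays for making them finite.
  obtain ⟨N, hN⟩ := exists_nat_one_div_lt (half_pos hδ)
  set D : ℕ := N + 1
  have hD : (0 : ℝ) < D := by positivity
  set m : ℝ≥0∞ := (Fintype.card (Fin k → Bool) : ℝ≥0∞)
  have hm0 : m ≠ 0 := by simp [m]
  have hmt : m ≠ ∞ := by simp [m]
  have hε : ENNReal.ofReal (δ / 2) / m ≠ 0 := by simp [hmt, hδ]
  have hγ (u : List Bool) : ∃ γ, (∀ b, G.loss b γ ≠ ∞) ∧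
      G.wordLoss P u γ ≤ (⨅ γ, G.wordLoss P u γ) + ENNReal.ofReal (δ / 2) / m := by
    obtain ⟨γ, hγ⟩ := hG.exists_wordLoss_le (P := P) u
    obtain ⟨γ', h1, h2⟩ := hG.exists_finite_le (measure_ne_top P (_root_.cylinder (u ++ [false])))
      (measure_ne_top P (_root_.cylinder (u ++ [true]))) hε γ
    exact ⟨γ', h1, h2.trans (add_le_add_left (le_iInf hγ) _)⟩
  choose γ hfin hle using hγ
  refine ⟨D, fun u b => ⌈(D : ℝ) * (G.loss b (γ u)).toReal⌉₊, N.succ_pos,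
    fun u => ⟨γ u, fun b => ?_⟩, ?_⟩
  · rw [← EReal.coe_ennreal_toReal (hfin u b), EReal.coe_le_coe_iff, le_div_iff₀ hD, mul_comm]
    exact Nat.le_ceil _
  have hcost (u : List Bool) (b : Bool) :
      ENNReal.ofReal ((⌈(D : ℝ) * (G.loss b (γ u)).toReal⌉₊ : ℝ) / D)
        ≤ G.loss b (γ u) + ENNReal.ofReal (δ / 2) := by
    rw [← ENNReal.ofReal_toReal (hfin u b),
      ← ENNReal.ofReal_add ENNReal.toReal_nonneg (by positivity),
      ENNReal.toReal_ofReal ENNReal.toReal_nonneg]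
    refine ENNReal.ofReal_le_ofReal ?_
    have h1 := Nat.ceil_lt_add_one (a := (D : ℝ) * (G.loss b (γ u)).toReal) (by positivity)
    have h2 : 1 / (D : ℝ) < δ / 2 := by simpa [D] using hN
    rw [div_lt_iff₀ hD] at h2
    rw [div_le_iff₀ hD]
    nlinarith
  have hone := lintegral_prefix_next P k fun _ _ => 1
  simp only [lintegral_const, measure_univ, mul_one] at hone
  calc ∫⁻ ω, ENNReal.ofReal ((⌈(D : ℝ) * (G.loss (ω k) (γ (pre ω k))).toReal⌉₊ : ℝ) / D) ∂P
      ≤ ∫⁻ ω, (fun u b => G.loss b (γ u) + ENNReal.ofReal (δ / 2)) (pre ω k) (ω k) ∂P :=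
        lintegral_mono fun ω => hcost _ _
    _ = ∑ u : Fin k → Bool, (G.wordLoss P (List.ofFn u) (γ (List.ofFn u))
          + (P (_root_.cylinder (List.ofFn u ++ [false]))
            + P (_root_.cylinder (List.ofFn u ++ [true]))) * ENNReal.ofReal (δ / 2)) := by
        refine (lintegral_prefix_next P k fun u b =>
          G.loss b (γ u) + ENNReal.ofReal (δ / 2)).trans ?_
        refine Finset.sum_congr rfl fun u _ => ?_
        rw [wordLoss]
        ring
    _ ≤ ∑ u : Fin k → Bool, (((⨅ γ, G.wordLoss P (List.ofFn u) γ) + ENNReal.ofReal (δ / 2) / m)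
          + (P (_root_.cylinder (List.ofFn u ++ [false]))
            + P (_root_.cylinder (List.ofFn u ++ [true]))) * ENNReal.ofReal (δ / 2)) := by
        gcongr with u
        exact hle _
    _ = G.stepEntropy P k + ENNReal.ofReal (δ / 2) + ENNReal.ofReal (δ / 2) := by
        rw [Finset.sum_add_distrib, Finset.sum_add_distrib, ← Finset.sum_mul, ← hone, one_mul,
          Finset.sum_const, Finset.card_univ, nsmul_eq_mul, ENNReal.mul_div_cancel hm0 hmt,
          stepEntropy]
    _ = G.stepEntropy P k + ENNReal.ofReal δ := by
        rw [add_assoc, ← ENNReal.ofReal_add (by positivity) (by positivity), add_halves]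

theorem IsPredictiveComplexity.ae_eventually_div_le {K : List Bool → EReal}
    (hK : G.IsPredictiveComplexity K) (hG : G.IsRegular) (hP : Ergodic shift P) (k : ℕ) {δ : ℝ}
    (hδ : 0 < δ) :
    ∀ᵐ ω ∂P, ∀ᶠ n : ℕ in atTop,
      K (pre ω n) / (n : EReal) ≤ (((G.stepEntropy P k).toReal + δ : ℝ) : EReal) := by
  obtain ⟨D, c, hD, hc, hint⟩ := hG.exists_windowCost (P := P) k (half_pos hδ)
  set cost : (Fin k → Bool) → Bool → ℕ := fun u b => c (List.ofFn u) b
  set init : Fin k → Bool := fun _ => false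
  obtain ⟨C, hC⟩ := hK.2 _ (G.isSuperloss_automaton (windowStep k) cost init hD fun u => hc _)
  set L : List Bool → ℝ := fun x => ((automatonRun (windowStep k) cost init x).2 : ℝ) / D with hL
  set φ : (ℕ → Bool) → ℝ := fun ω => (cost (fun i => ω i) (ω k) : ℝ) / D with hφ
  have hφ0 (ω) : 0 ≤ φ ω := by positivity
  have hφm : Measurable φ := measurable_prefix_next k fun x b => (c x b : ℝ) / D
  have htop : G.stepEntropy P k + ENNReal.ofReal (δ / 2) ≠ ∞ :=
    ENNReal.add_ne_top.2 ⟨stepEntropy_ne_top hG k, ENNReal.ofReal_ne_top⟩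
  have hφi : Integrable φ P :=
    (lintegral_ofReal_ne_top_iff_integrable hφm.aestronglyMeasurable (ae_of_all _ hφ0)).1
      (ne_top_of_le_ne_top htop hint)
  have hmean : ∫ ω, φ ω ∂P < (G.stepEntropy P k).toReal + δ := by
    rw [integral_eq_lintegral_of_nonneg_ae (ae_of_all _ hφ0) hφm.aestronglyMeasurable]
    refine (ENNReal.toReal_mono htop hint).trans_lt ?_
    rw [ENNReal.toReal_add (stepEntropy_ne_top hG k) ENNReal.ofReal_ne_top,
      ENNReal.toReal_ofReal (by positivity)]
    linarith
  filter_upwards [ae_tendsto_birkhoffSum_div hP hφm hφi] with ω hω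
  have h1 : Tendsto (fun n : ℕ => (C + L (pre ω k)) / n + birkhoffSum shift φ n ω / n) atTop
      (𝓝 (0 + ∫ ω, φ ω ∂P)) := (tendsto_const_div_atTop_nhds_zero_nat _).add hω
  rw [zero_add] at h1
  have h2 := (h1.eventually (gt_mem_nhds hmean)).and (eventually_gt_atTop 0)
  obtain ⟨N, hN⟩ := eventually_atTop.1 h2
  filter_upwards [eventually_ge_atTop (N + k)] with m hm
  obtain ⟨n, rfl⟩ : ∃ n, m = n + k := ⟨m - k, by omega⟩
  obtain ⟨h3, h4⟩ := hN n (by omega)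
  have hn : (0 : ℝ) < n := by exact_mod_cast h4
  -- Since the bound is nonnegative, it survives replacing the divisor n by n + k.
  have hv : 0 ≤ (G.stepEntropy P k).toReal + δ := by positivity
  have h5 : (L (pre ω (n + k)) + C) / ((n + k : ℕ) : ℝ) ≤ (G.stepEntropy P k).toReal + δ := by
    rw [← add_div, div_lt_iff₀ hn] at h3
    rw [div_le_iff₀ (by positivity)]
    have := automatonRun_window_eq_birkhoffSum k cost init D ω n
    have h6 : (0 : ℝ) ≤ k := Nat.cast_nonneg k
    push_cast
    simp only [hL, hφ] at this h3 ⊢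
    nlinarith
  refine (EReal.div_le_div_right_of_nonneg (by positivity) (hC _)).trans ?_
  rw [← EReal.coe_add, ← EReal.coe_natCast, ← EReal.coe_div]
  exact EReal.coe_le_coe_iff.2 h5

end Game

/-! ### Ergodicity of the two-sided extension. -/

section TwoSided

/-- The coordinates `0, 1, 2, …` of a two-sided sequence. -/
def nonnegPart (ω : ℤ → Bool) : ℕ → Bool := fun n => ω n

theorem measurable_nonnegPart : Measurable nonnegPart :=
  measurable_pi_lambda _ fun n => measurable_pi_apply (n : ℤ)

theorem nonnegPart_shiftZ (ω : ℤ → Bool) : nonnegPart (shiftZ ω) = shift (nonnegPart ω) := by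
  ext n
  simp [nonnegPart, shiftZ, shift]

theorem iterate_shiftZ (ω : ℤ → Bool) (n : ℕ) (i : ℤ) : shiftZ^[n] ω i = ω (i + n) := by
  induction n generalizing ω with
  | zero => simp
  | succ n ih =>
    rw [Function.iterate_succ_apply, ih, shiftZ]
    congr 1
    push_cast
    ring

namespace IsTwoSidedExtension

variable {P : Measure (ℕ → Bool)} {Q : Measure (ℤ → Bool)}

theorem map_nonnegPart (h : IsTwoSidedExtension P Q) : Q.map nonnegPart = P := h.law

theorem isProbabilityMeasure (h : IsTwoSidedExtension P Q) [IsProbabilityMeasure P] :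
    IsProbabilityMeasure Q := by
  have := h.map_nonnegPart
  exact ⟨by rw [← measure_univ (μ := P), ← this, Measure.map_apply measurable_nonnegPart .univ,
    Set.preimage_univ]⟩

open scoped symmDiff in
-- A is close to a set depending on finitely many coordinates. Shifting moves those coordinates to
-- nonnegative times, while A and the measure are unchanged.
theorem exists_measure_symmDiff_lt (h : IsTwoSidedExtension P Q) [IsProbabilityMeasure Q]
    {A : Set (ℤ → Bool)} (hA : MeasurableSet A) (hinv : shiftZ ⁻¹' A = A) {ε : ℝ} (hε : 0 < ε) :
    ∃ B : Set (ℕ → Bool), MeasurableSet B ∧ Q (A ∆ (nonnegPart ⁻¹' B)) < ENNReal.ofReal ε := by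
  have hdense : Q.MeasureDense (measurableCylinders fun _ : ℤ => Bool) :=
    Measure.MeasureDense.of_generateFrom_isSetAlgebra_finite Q isSetAlgebra_measurableCylinders
      generateFrom_measurableCylinders.symm
  obtain ⟨t, ht, hlt⟩ := hdense.approx A hA (measure_ne_top _ _) ε hε
  have htm := hdense.measurable t ht
  obtain ⟨s, S, hS, rfl⟩ := (mem_measurableCylinders t).1 ht
  obtain ⟨m, hm⟩ : ∃ m : ℕ, ∀ i ∈ s, 0 ≤ i + m := by
    refine ⟨∑ i ∈ s, i.natAbs, fun i hi => ?_⟩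
    have := Finset.single_le_sum (f := Int.natAbs) (fun _ _ => Nat.zero_le _) hi
    omega
  refine ⟨{η | (fun i : s => η ((i : ℤ) + m).toNat) ∈ S}, ?_, ?_⟩
  · exact (measurable_pi_lambda _ fun i : s => measurable_pi_apply _) hS
  · have h1 : nonnegPart ⁻¹' {η | (fun i : s => η ((i : ℤ) + m).toNat) ∈ S}
        = shiftZ^[m] ⁻¹' (MeasureTheory.cylinder s S) := by
      ext ω
      simp only [Set.mem_preimage, Set.mem_ofPred_eq, MeasureTheory.mem_cylinder]
      have : (fun i : s => nonnegPart ω ((i : ℤ) + m).toNat) = s.restrict (shiftZ^[m] ω) := by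
        ext i
        simp [nonnegPart, iterate_shiftZ, Int.toNat_of_nonneg (hm i i.2)]
      rw [this]
    have h2 : A = shiftZ^[m] ⁻¹' A := by
      rw [Set.preimage_iterate_eq]
      exact (Function.IsFixedPt.iterate (f := Set.preimage shiftZ) hinv m).symm
    rw [h1]
    nth_rw 1 [h2]
    rw [← Set.preimage_symmDiff,
      (h.invariant.iterate m).measure_preimage (hA.symmDiff htm).nullMeasurableSet]
    exact hlt

/-- The two-sided extension of an ergodic measure is ergodic. -/
theorem ergodic (h : IsTwoSidedExtension P Q) [IsProbabilityMeasure P] (hP : Ergodic shift P) :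
    Ergodic shiftZ Q := by
  have := h.isProbabilityMeasure
  refine ⟨h.invariant, ⟨fun {A} hA hinv => ?_⟩⟩
  -- The errors are summable, so by Borel–Cantelli A coincides almost surely with the pullback of
  -- limsup B_n, a one-sided event to which the ergodicity of P applies.
  have hex (n : ℕ) := h.exists_measure_symmDiff_lt hA hinv (ε := (1 / 2) ^ n) (by positivity)
  choose B hB hBlt using hex
  have hsum : ∑' n, Q (symmDiff A (nonnegPart ⁻¹' B n)) ≠ ∞ := by
    refine ne_top_of_le_ne_top ?_ (ENNReal.tsum_le_tsum fun n => (hBlt n).le)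
    rw [← ENNReal.ofReal_tsum_of_nonneg (fun n => by positivity) summable_geometric_two]
    exact ENNReal.ofReal_ne_top
  set C := limsup B atTop
  have hC : MeasurableSet C := MeasurableSet.measurableSet_limsup hB
  have hAC : ∀ᵐ ω ∂Q, ω ∈ A ↔ nonnegPart ω ∈ C := by
    filter_upwards [ae_eventually_notMem hsum] with ω hω
    have hω' : ∀ᶠ n in atTop, (ω ∈ A ↔ nonnegPart ω ∈ B n) := hω.mono fun n hn => by
      simp only [Set.mem_symmDiff, Set.mem_preimage] at hn
      tauto
    rw [mem_limsup_iff_frequently_mem, ← frequently_congr hω', frequently_const]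
  have hCinv : shift ⁻¹' C =ᵐ[P] C := by
    rw [← h.map_nonnegPart, eventuallyEq_set]
    refine (ae_map_iff measurable_nonnegPart.aemeasurable
      (((measurable_shift hC).mem.iff hC.mem).setOf)).2 ?_
    filter_upwards [hAC, h.invariant.quasiMeasurePreserving.ae hAC] with ω h1 h2
    rw [Set.mem_preimage, ← nonnegPart_shiftZ, ← h1, ← h2, ← Set.mem_preimage, hinv]
  have hconst := hP.quasiErgodic.aeconst_set₀ hC.nullMeasurableSet hCinv
  rw [eventuallyConst_set'] at hconst ⊢
  have htrans {p : (ℕ → Bool) → Prop} (hp : ∀ᵐ η ∂P, p η) : ∀ᵐ ω ∂Q, p (nonnegPart ω) := by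
    rw [← h.map_nonnegPart] at hp
    exact ae_of_ae_map measurable_nonnegPart.aemeasurable hp
  refine hconst.imp (fun h0 => ?_) fun h0 => ?_
  all_goals
    rw [eventuallyEq_set] at h0 ⊢
    filter_upwards [hAC, htrans h0] with ω h1 h2
    exact h1.trans h2

end IsTwoSidedExtension

end TwoSided

/-! ### Conditional probabilities given sets of coordinates. -/

section Conditioning

variable {Ω : Type*} {m m₀ : MeasurableSpace Ω} {μ : Measure[m₀] Ω}

/-- On the smaller σ-algebra, q is the density of the restriction of μ to A. This form allows X to
be infinite or non-integrable, as losses may be. -/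
theorem setLIntegral_eq_lintegral_mul_of_trim (hm : m ≤ m₀) [IsFiniteMeasure μ] {A : Set Ω}
    {q X : Ω → ℝ≥0∞} (hq : Measurable[m] q) (hX : Measurable[m] X)
    (h : ∀ B, MeasurableSet[m] B → μ (B ∩ A) = ∫⁻ ω in B, q ω ∂μ) :
    ∫⁻ ω in A, X ω ∂μ = ∫⁻ ω, q ω * X ω ∂μ := by
  have h1 : (μ.restrict A).trim hm = (μ.trim hm).withDensity q := by
    refine @Measure.ext _ m _ _ fun B hB => ?_
    rw [trim_measurableSet_eq hm hB, Measure.restrict_apply (hm _ hB), h B hB,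
      withDensity_apply _ hB, restrict_trim hm _ hB, lintegral_trim hm hq]
  rw [← lintegral_trim hm hX, h1, lintegral_withDensity_eq_lintegral_mul _ hq hX,
    lintegral_trim hm (hq.mul hX)]
  rfl

theorem setLIntegral_eq_lintegral_ofReal_mul (hm : m ≤ m₀) [IsFiniteMeasure μ] {A : Set Ω}
    {q : Ω → ℝ} {X : Ω → ℝ≥0∞} (hq : Measurable[m] q)
    (hX : Measurable[m] X) (hqi : Integrable q μ) (hq0 : 0 ≤ q)
    (h : ∀ B, MeasurableSet[m] B → ∫ ω in B, q ω ∂μ = μ.real (B ∩ A)) :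
    ∫⁻ ω in A, X ω ∂μ = ∫⁻ ω, ENNReal.ofReal (q ω) * X ω ∂μ := by
  refine setLIntegral_eq_lintegral_mul_of_trim hm hq.ennreal_ofReal hX fun B hB => ?_
  rw [← ofReal_integral_eq_lintegral_ofReal hqi.integrableOn (ae_of_all _ hq0), h B hB,
    Measure.real, ENNReal.ofReal_toReal (measure_ne_top _ _)]

end Conditioning

theorem measurable_bool_select {Ω β : Type*} {m : MeasurableSpace Ω} [MeasurableSpace β]
    {X : Bool → Ω → β} {c : Ω → Bool} (hX : ∀ b, Measurable (X b)) (hc : Measurable c) :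
    Measurable fun ω => X (c ω) ω := by
  have h : (fun ω => X (c ω) ω) = fun ω => if c ω = true then X true ω else X false ω := by
    ext ω
    cases h : c ω <;> simp
  rw [h]
  exact Measurable.ite (hc (measurableSet_singleton true)) (hX true) (hX false)

section Coordinates

/-- The σ-algebra generated by the coordinates in `S`. -/
@[reducible] def coordSpace (S : Set ℤ) : MeasurableSpace (ℤ → Bool) :=
  MeasurableSpace.comap (fun (ω : ℤ → Bool) (i : S) => ω i) inferInstance

theorem coordSpace_le (S : Set ℤ) : coordSpace S ≤ MeasurableSpace.pi :=
  (measurable_pi_lambda _ fun i : S => measurable_pi_apply (i : ℤ)).comap_le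

theorem measurable_coord {S : Set ℤ} {i : ℤ} (hi : i ∈ S) :
    Measurable[coordSpace S] fun ω : ℤ → Bool => ω i :=
  (measurable_pi_apply (⟨i, hi⟩ : S)).comp (comap_measurable fun (ω : ℤ → Bool) (i : S) => ω i)

theorem coordSpace_le_iff {S : Set ℤ} {m : MeasurableSpace (ℤ → Bool)} :
    coordSpace S ≤ m ↔ ∀ i ∈ S, Measurable[m] fun ω : ℤ → Bool => ω i := by
  rw [coordSpace, ← measurable_iff_comap_le, measurable_pi_iff]
  simp

theorem coordSpace_mono {S T : Set ℤ} (h : S ⊆ T) : coordSpace S ≤ coordSpace T :=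
  coordSpace_le_iff.2 fun _ hi => measurable_coord (h hi)

theorem iSup_coordSpace_Ico :
    ⨆ n : ℕ, coordSpace (Set.Ico (-(n : ℤ)) 0) = coordSpace (Set.Iio 0) := by
  refine le_antisymm (iSup_le fun n => coordSpace_mono fun i hi => hi.2)
    (coordSpace_le_iff.2 fun i hi => ?_)
  refine (measurable_coord (S := Set.Ico (-(i.natAbs : ℤ)) 0) ⟨?_, hi⟩).mono
    (le_iSup (fun n : ℕ => coordSpace (Set.Ico (-(n : ℤ)) 0)) i.natAbs) le_rfl
  omega

variable {Q : Measure (ℤ → Bool)} {S : Set ℤ}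

theorem measurable_condProbZero : Measurable[coordSpace S] (condProbZero Q S) :=
  continuous_projIcc.measurable.comp stronglyMeasurable_condExp.measurable

theorem measurableSet_coord_eq (i : ℤ) (b : Bool) : MeasurableSet {ω : ℤ → Bool | ω i = b} :=
  (measurable_pi_apply (X := fun _ : ℤ => Bool) i) (measurableSet_singleton b)

variable [IsProbabilityMeasure Q]

theorem coe_condProbZero_ae_eq :
    (fun ω => (condProbZero Q S ω : ℝ)) =ᵐ[Q]
      Q⟦{ω : ℤ → Bool | ω 0 = false} | coordSpace S⟧ := by
  have hi : Integrable ({ω : ℤ → Bool | ω 0 = false}.indicator fun _ => (1 : ℝ)) Q :=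
    (integrable_const 1).indicator (measurableSet_coord_eq 0 false)
  have h0 := condExp_nonneg (μ := Q) (m := coordSpace S)
    (f := {ω : ℤ → Bool | ω 0 = false}.indicator fun _ => (1 : ℝ))
    (ae_of_all _ fun ω => Set.indicator_nonneg (fun _ _ => zero_le_one) ω)
  have h1 := condExp_mono (m := coordSpace S) hi (integrable_const (1 : ℝ))
    (ae_of_all _ fun ω => Set.indicator_le_self' (fun _ _ => zero_le_one) ω)
  rw [condExp_const (coordSpace_le S)] at h1
  filter_upwards [h0, h1] with ω h2 h3
  exact congrArg Subtype.val (Set.projIcc_of_mem zero_le_one ⟨h2, h3⟩)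

theorem setIntegral_condProbZero {B : Set (ℤ → Bool)} (hB : MeasurableSet[coordSpace S] B) :
    ∫ ω in B, (condProbZero Q S ω : ℝ) ∂Q = Q.real (B ∩ {ω | ω 0 = false}) := by
  rw [integral_congr_ae (ae_restrict_of_ae coe_condProbZero_ae_eq),
    setIntegral_condExp (coordSpace_le S)
      ((integrable_const 1).indicator (measurableSet_coord_eq 0 false)) hB,
    setIntegral_indicator (measurableSet_coord_eq 0 false)]
  simp

theorem integrable_condProbZero : Integrable (fun ω => (condProbZero Q S ω : ℝ)) Q :=
  integrable_condExp.congr coe_condProbZero_ae_eq.symm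

/-- Integration of a function of the coordinates in `S` and of the outcome at time `0`. -/
theorem lintegral_coord_zero {X : Bool → (ℤ → Bool) → ℝ≥0∞}
    (hX : ∀ b, Measurable[coordSpace S] (X b)) :
    ∫⁻ ω, X (ω 0) ω ∂Q = ∫⁻ ω, (ENNReal.ofReal (condProbZero Q S ω) * X false ω
      + ENNReal.ofReal (1 - condProbZero Q S ω) * X true ω) ∂Q := by
  have hp : Measurable[coordSpace S] fun ω => (condProbZero Q S ω : ℝ) :=
    measurable_subtype_coe.comp measurable_condProbZero
  have hA := measurableSet_coord_eq 0 false
  have hAc : {ω : ℤ → Bool | ω 0 = false}ᶜ = {ω | ω 0 = true} := by ext; simp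
  have h0 : ∫⁻ ω in {ω | ω 0 = false}, X (ω 0) ω ∂Q
      = ∫⁻ ω, ENNReal.ofReal (condProbZero Q S ω) * X false ω ∂Q := by
    rw [← setLIntegral_eq_lintegral_ofReal_mul (coordSpace_le S) hp (hX false)
      integrable_condProbZero (fun ω => (condProbZero Q S ω).2.1) fun B => setIntegral_condProbZero]
    refine setLIntegral_congr_fun hA fun ω hω => ?_
    simp only [Set.mem_ofPred_eq] at hω
    simp [hω]
  have h1 : ∫⁻ ω in {ω | ω 0 = false}ᶜ, X (ω 0) ω ∂Q
      = ∫⁻ ω, ENNReal.ofReal (1 - condProbZero Q S ω) * X true ω ∂Q := by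
    rw [← setLIntegral_eq_lintegral_ofReal_mul (coordSpace_le S)
      (q := fun ω => 1 - condProbZero Q S ω)
      (measurable_const.sub hp) (hX true) ((integrable_const 1).sub integrable_condProbZero)
      (fun ω => sub_nonneg.2 (condProbZero Q S ω).2.2) fun B hB => ?_]
    · refine setLIntegral_congr_fun hA.compl fun ω hω => ?_
      rw [hAc] at hω
      simp only [Set.mem_ofPred_eq] at hω
      simp [hω]
    · rw [integral_sub (integrable_const 1).integrableOn integrable_condProbZero.integrableOn,
        setIntegral_condProbZero hB, ← Set.sdiff_eq]
      have := measureReal_inter_add_sdiff (μ := Q) (s := B) hA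
      simp only [integral_const, measureReal_restrict_apply_univ, smul_eq_mul, mul_one]
      linarith
  rw [← lintegral_add_compl _ hA, h0, h1, lintegral_add_left]
  exact ((hp.ennreal_ofReal.mul (hX false)).mono (coordSpace_le S) le_rfl)

/-- Lévy's upward theorem: the finite pasts generate the σ-algebra of the whole past. -/
theorem ae_tendsto_condProbZero :
    ∀ᵐ ω ∂Q, Tendsto (fun n : ℕ => condProbZero Q (Set.Ico (-(n : ℤ)) 0) ω) atTop
      (𝓝 (condProbZero Q (Set.Iio 0) ω)) := by
  let ℱ : Filtration ℕ (MeasurableSpace.pi : MeasurableSpace (ℤ → Bool)) :=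
    { seq := fun n => coordSpace (Set.Ico (-(n : ℤ)) 0)
      mono' := fun a b hab => coordSpace_mono (Set.Ico_subset_Ico_left (by
        simp only [neg_le_neg_iff]; exact_mod_cast hab))
      le' := fun n => coordSpace_le _ }
  have h := tendsto_ae_condExp (μ := Q) (ℱ := ℱ)
    ({ω : ℤ → Bool | ω 0 = false}.indicator fun _ => (1 : ℝ))
  have hsup : ⨆ n, ℱ n = coordSpace (Set.Iio 0) := iSup_coordSpace_Ico
  rw [hsup] at h
  filter_upwards [h] with ω hω
  exact (continuous_projIcc.tendsto _).comp hω

end Coordinates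

/-! ### The optimal predictor that knows the infinite past. -/

namespace Game

variable {G : Game} {s : I → I} {P : Measure (ℕ → Bool)} {Q : Measure (ℤ → Bool)}

theorem IsRegular.measurable_lossAtZero (hG : G.IsRegular) (hs : Continuous s) (S : Set ℤ) :
    Measurable (G.lossAtZero s Q S) := by
  have h (b : Bool) : Measurable fun ω => G.loss b (s (condProbZero Q S ω)) :=
    ((hG.continuous b).measurable.comp hs.measurable).comp
      (measurable_condProbZero.mono (coordSpace_le S) le_rfl)
  exact measurable_bool_select h (measurable_pi_apply 0)

theorem IsRegular.lintegral_lossAtZero [IsProbabilityMeasure Q] (hG : G.IsRegular)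
    (hs : Continuous s) (S : Set ℤ) :
    ∫⁻ ω, G.lossAtZero s Q S ω ∂Q
      = ∫⁻ ω, G.expLoss (condProbZero Q S ω) (s (condProbZero Q S ω)) ∂Q :=
  lintegral_coord_zero (X := fun b ω => G.loss b (s (condProbZero Q S ω))) fun b =>
    ((hG.continuous b).measurable.comp hs.measurable).comp measurable_condProbZero

theorem expLoss_le (p γ : I) : G.expLoss p γ ≤ G.loss false γ + G.loss true γ := by
  refine add_le_add (mul_le_of_le_one_left' ?_) (mul_le_of_le_one_left' ?_)
  · exact ENNReal.ofReal_le_one.2 p.2.2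
  · exact ENNReal.ofReal_le_one.2 (by linarith [p.2.1])

/-- By stationarity time 0 may be moved to time k. There a predictor using the last k outcomes is a
function of the prefix, hence a competitor in the infimum. -/
theorem stepEntropy_le_lintegral_lossAtZero (hQ : IsTwoSidedExtension P Q) (k : ℕ)
    (hG : G.IsRegular) (hs : Continuous s) :
    G.stepEntropy P k ≤ ∫⁻ ω, G.lossAtZero s Q (Set.Ico (-(k : ℤ)) 0) ω ∂Q := by
  -- Doob–Dynkin: the chosen version of the conditional probability is, at every point, a function
  -- of the k coordinates.
  obtain ⟨φ, -, hφ⟩ := (measurable_condProbZero (Q := Q)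
    (S := Set.Ico (-(k : ℤ)) 0)).exists_eq_measurable_comp
  set h : List Bool → Bool → ℝ≥0∞ := fun x b =>
    G.loss b (s (φ fun i => x.getD ((i : ℤ) + k).toNat false))
  have h1 (ω : ℤ → Bool) : G.lossAtZero s Q (Set.Ico (-(k : ℤ)) 0) (shiftZ^[k] ω)
      = h (pre (nonnegPart ω) k) (nonnegPart ω k) := by
    have h2 : (fun i : Set.Ico (-(k : ℤ)) 0 => ω (i + k))
        = fun i : Set.Ico (-(k : ℤ)) 0 =>
          (pre (nonnegPart ω) k).getD ((i : ℤ) + k).toNat false := by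
      ext i
      obtain ⟨h3, h4⟩ := i.2
      have h5 : ((i : ℤ) + k).toNat < k := by omega
      rw [List.getD_eq_getElem _ _ (by simpa using h5)]
      simp only [pre, List.getElem_ofFn, nonnegPart]
      congr 1
      omega
    simp only [lossAtZero, hφ, Function.comp_apply, h2, h, iterate_shiftZ, nonnegPart, zero_add]
  rw [← (hQ.invariant.iterate k).lintegral_comp (hG.measurable_lossAtZero hs _)]
  simp only [h1]
  rw [← lintegral_map (μ := Q) (f := fun η => h (pre η k) (η k)) (measurable_prefix_next k h)
    measurable_nonnegPart, hQ.map_nonnegPart, lintegral_prefix_next]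
  exact Finset.sum_le_sum fun u _ => iInf_le _ _

/-- An infimum of continuous functions is upper semicontinuous. As q ↦ `expLoss q γ` is continuous
when both losses at γ are finite, s(p) is first replaced by a nearly optimal such γ. -/
theorem IsRegular.limsup_expLoss_le (hG : G.IsRegular)
    (hmin : ∀ p γ : I, G.expLoss p (s p) ≤ G.expLoss p γ) {u : ℕ → I} {p : I}
    (hu : Tendsto u atTop (𝓝 p)) :
    limsup (fun n => G.expLoss (u n) (s (u n))) atTop ≤ G.expLoss p (s p) := by
  refine ENNReal.le_of_forall_pos_le_add fun ε hε _ => ?_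
  obtain ⟨γ, hfin, hγ⟩ := hG.exists_finite_le (a := ENNReal.ofReal p)
    (c := ENNReal.ofReal (1 - p)) ENNReal.ofReal_ne_top ENNReal.ofReal_ne_top
    (ε := ε) (by exact_mod_cast hε.ne') (s p)
  have hc : Continuous fun q : I => G.expLoss q γ :=
    ((ENNReal.continuous_mul_const (hfin false)).comp
      (ENNReal.continuous_ofReal.comp continuous_subtype_val)).add
    ((ENNReal.continuous_mul_const (hfin true)).comp
      (ENNReal.continuous_ofReal.comp (continuous_const.sub continuous_subtype_val)))
  calc limsup (fun n => G.expLoss (u n) (s (u n))) atTop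
      ≤ limsup (fun n => G.expLoss (u n) γ) atTop :=
        limsup_le_limsup (Eventually.of_forall fun n => hmin _ _)
    _ = G.expLoss p γ := ((hc.tendsto p).comp hu).limsup_eq
    _ ≤ G.expLoss p (s p) + ε := hγ

theorem IsRegular.lintegral_lossAtZero_ne_top [IsProbabilityMeasure Q] (hG : G.IsRegular)
    (hs : Continuous s) (hmin : ∀ p γ : I, G.expLoss p (s p) ≤ G.expLoss p γ) (S : Set ℤ) :
    ∫⁻ ω, G.lossAtZero s Q S ω ∂Q ≠ ∞ := by
  obtain ⟨γ, hγ⟩ := hG.exists_finite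
  rw [hG.lintegral_lossAtZero hs]
  refine ne_top_of_le_ne_top ?_ (lintegral_mono fun ω => (hmin _ γ).trans (expLoss_le _ γ))
  simpa using ⟨(hγ false).ne, (hγ true).ne⟩

/-- The limit of the optimal finite-memory losses is at most the mean loss of the optimal
predictor that knows the infinite past. -/
theorem IsRegular.iInf_stepEntropy_le [IsProbabilityMeasure Q] (hG : G.IsRegular)
    (hQ : IsTwoSidedExtension P Q) (hs : Continuous s)
    (hmin : ∀ p γ : I, G.expLoss p (s p) ≤ G.expLoss p γ) :
    ⨅ k, G.stepEntropy P k ≤ ∫⁻ ω, G.lossAtZero s Q (Set.Iio 0) ω ∂Q := by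
  obtain ⟨γ, hγ⟩ := hG.exists_finite
  rw [hG.lintegral_lossAtZero hs]
  have hmeas : Measurable fun p : I => G.expLoss p (s p) :=
    ((ENNReal.measurable_ofReal.comp measurable_subtype_coe).mul
      ((hG.continuous false).comp hs).measurable).add
    ((ENNReal.measurable_ofReal.comp (measurable_const.sub measurable_subtype_coe)).mul
      ((hG.continuous true).comp hs).measurable)
  calc ⨅ k, G.stepEntropy P k
      ≤ limsup (fun k : ℕ => ∫⁻ ω, G.expLoss (condProbZero Q (Set.Ico (-(k : ℤ)) 0) ω)
          (s (condProbZero Q (Set.Ico (-(k : ℤ)) 0) ω)) ∂Q) atTop := by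
        refine le_limsup_of_frequently_le (Frequently.of_forall fun k => ?_)
        rw [← hG.lintegral_lossAtZero hs]
        exact (iInf_le _ k).trans (stepEntropy_le_lintegral_lossAtZero hQ k hG hs)
    _ ≤ ∫⁻ ω, limsup (fun k : ℕ => G.expLoss (condProbZero Q (Set.Ico (-(k : ℤ)) 0) ω)
          (s (condProbZero Q (Set.Ico (-(k : ℤ)) 0) ω))) atTop ∂Q := by
        -- The dominating function is constant: the minimal expected loss never exceeds the sum of
        -- the two losses at a finite γ.
        refine limsup_lintegral_le (fun _ => G.loss false γ + G.loss true γ)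
          (fun k => hmeas.comp (measurable_condProbZero.mono (coordSpace_le _) le_rfl))
          (fun k => ae_of_all _ fun ω => (hmin _ γ).trans (expLoss_le _ γ)) ?_
        simpa using ⟨(hγ false).ne, (hγ true).ne⟩
    _ ≤ ∫⁻ ω, G.expLoss (condProbZero Q (Set.Iio 0) ω)
          (s (condProbZero Q (Set.Iio 0) ω)) ∂Q :=
        lintegral_mono_ae (ae_tendsto_condProbZero.mono fun ω hω => hG.limsup_expLoss_le hmin hω)

end Game

/-! ### Mixability as a bound on exponentiated regrets. -/

section Mixability

/-- First-order optimality of the logarithmic score. -/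
theorem add_mul_le_one_of_log_le {q₀ q₁ r₀ r₁ : ℝ} (h₀ : 0 ≤ q₀) (h₁ : 0 ≤ q₁) (hq : q₀ + q₁ = 1)
    (hr₀ : 0 ≤ r₀) (hr₁ : 0 ≤ r₁)
    (h : ∀ t : ℝ, 0 < t → t < 1 →
      q₀ * Real.log (1 + t * (r₀ - 1)) + q₁ * Real.log (1 + t * (r₁ - 1)) ≤ 0) :
    q₀ * r₀ + q₁ * r₁ ≤ 1 := by
  have hlim : Tendsto (fun t : ℝ => q₀ * ((r₀ - 1) / (1 + t * (r₀ - 1)))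
      + q₁ * ((r₁ - 1) / (1 + t * (r₁ - 1)))) (𝓝[>] 0)
      (𝓝 (q₀ * ((r₀ - 1) / (1 + 0 * (r₀ - 1))) + q₁ * ((r₁ - 1) / (1 + 0 * (r₁ - 1))))) := by
    refine Tendsto.mono_left (ContinuousAt.tendsto ?_) nhdsWithin_le_nhds
    fun_prop (disch := norm_num)
  have hev : ∀ᶠ t : ℝ in 𝓝[>] 0, q₀ * ((r₀ - 1) / (1 + t * (r₀ - 1)))
      + q₁ * ((r₁ - 1) / (1 + t * (r₁ - 1))) ≤ 0 := by
    filter_upwards [Ioo_mem_nhdsGT (zero_lt_one (α := ℝ))] with t ht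
    -- The bound log x ≥ 1 - 1/x replaces differentiation; dividing by t and letting t → 0 gives the
    -- first-order condition.
    have key (r : ℝ) (hr : 0 ≤ r) :
        t * ((r - 1) / (1 + t * (r - 1))) ≤ Real.log (1 + t * (r - 1)) := by
      have hpos : 0 < 1 + t * (r - 1) := by nlinarith [ht.1, ht.2, mul_nonneg ht.1.le hr]
      refine le_trans (le_of_eq ?_) (Real.one_sub_inv_le_log_of_pos hpos)
      field_simp
      ring
    have h2 := h t ht.1 ht.2
    have h3 := mul_le_mul_of_nonneg_left (key r₀ hr₀) h₀
    have h4 := mul_le_mul_of_nonneg_left (key r₁ hr₁) h₁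
    refine nonpos_of_mul_nonpos_right (a := t) ?_ ht.1
    linarith
  have := le_of_tendsto hlim hev
  simp only [zero_mul, add_zero, div_one] at this
  linarith

variable {β : ℝ}

theorem betaPow_nonneg (hβ : 0 < β) (x : EReal) : 0 ≤ betaPow β x := by
  unfold betaPow
  split_ifs
  · exact le_rfl
  · exact Real.rpow_nonneg hβ.le _

theorem betaPow_top : betaPow β ⊤ = 0 := by simp [betaPow]

theorem betaPow_coe (x : ℝ) : betaPow β x = β ^ x := by simp [betaPow]

theorem betaPow_coe_ennreal {x : ℝ≥0∞} (hx : x ≠ ∞) : betaPow β x = β ^ x.toReal := by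
  rw [← EReal.coe_ennreal_toReal hx, betaPow_coe]

theorem measurable_betaPow : Measurable (betaPow β) := by
  unfold betaPow
  exact Measurable.ite (measurableSet_singleton ⊤) measurable_const
    (measurable_const.pow measurable_ereal_toReal)

theorem log_betaPow_le (hβ : 0 < β) (hβ1 : β < 1) {l : ℝ≥0∞} {x : EReal} (hx : (l : EReal) ≤ x)
    (hpos : 0 < betaPow β x) : l ≠ ∞ ∧ Real.log (betaPow β x) ≤ Real.log β * l.toReal := by
  induction x with
  | bot => exact absurd (le_bot_iff.1 hx) (EReal.coe_ennreal_ne_bot l)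
  | top => simp [betaPow_top] at hpos
  | coe x =>
    have hl : l ≠ ∞ := by rintro rfl; simp at hx
    refine ⟨hl, ?_⟩
    rw [← EReal.coe_ennreal_toReal hl, EReal.coe_le_coe_iff] at hx
    rw [betaPow_coe, Real.log_rpow hβ, mul_comm]
    exact mul_le_mul_of_nonpos_left hx (Real.log_neg hβ hβ1).le

namespace Game

variable {G : Game}

/-- For a mixable game, exponentiated regrets with respect to an optimal prediction have mean at
most `1`. -/
theorem mean_betaPow_div_le_one (hβ : 0 < β) (hβ1 : β < 1)
    (hconv : Convex ℝ ((fun p : EReal × EReal => (betaPow β p.1, betaPow β p.2)) '' G.superscores))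
    {p γ : I} (hγ : ∀ γ', G.expLoss p γ ≤ G.expLoss p γ') (hfin : G.expLoss p γ ≠ ∞)
    {c : EReal × EReal} (hc : c ∈ G.superscores) :
    p * (betaPow β c.1 / betaPow β (G.loss false γ))
      + (1 - p) * (betaPow β c.2 / betaPow β (G.loss true γ)) ≤ 1 := by
  have hp0 : (0 : ℝ) ≤ p := p.2.1
  have hp1 : (0 : ℝ) ≤ 1 - p := by linarith [p.2.2]
  have hnn := betaPow_nonneg hβ
  refine add_mul_le_one_of_log_le hp0 hp1 (by ring) (div_nonneg (hnn _) (hnn _))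
    (div_nonneg (hnn _) (hnn _)) fun t ht0 ht1 => ?_
  have hmem : ((G.loss false γ : EReal), (G.loss true γ : EReal)) ∈ G.superscores :=
    ⟨EReal.coe_ennreal_ne_bot _, EReal.coe_ennreal_ne_bot _, γ, le_rfl, le_rfl⟩
  -- By convexity the mixture with weight t on c is again the image of a superscore, dominating the
  -- losses of some γ'. As γ' does no better than γ and log β < 0, the mean log-ratio is at most 0.
  obtain ⟨⟨z₀, z₁⟩, ⟨-, -, γ', hz₀, hz₁⟩, hz⟩ := hconv (Set.mem_image_of_mem _ hmem)
    (Set.mem_image_of_mem _ hc) (sub_nonneg.2 ht1.le) ht0.le (sub_add_cancel 1 t)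
  simp only [Prod.smul_mk, smul_eq_mul, Prod.mk_add_mk, Prod.mk.injEq] at hz hz₀ hz₁
  obtain ⟨hf0, hf1⟩ := ENNReal.add_ne_top.1 hfin
  -- the contribution of one outcome
  have key {q : ℝ} (hq : 0 ≤ q) {l l' : ℝ≥0∞} {x z : EReal} (hl : ENNReal.ofReal q * l ≠ ∞)
      (hzx : betaPow β z = (1 - t) * betaPow β l + t * betaPow β x) (hlz : (l' : EReal) ≤ z) :
      ENNReal.ofReal q * l' ≠ ∞ ∧
      q * Real.log (1 + t * (betaPow β x / betaPow β l - 1)) ≤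
        Real.log β * ((ENNReal.ofReal q * l').toReal - (ENNReal.ofReal q * l).toReal) := by
    -- An infinite loss of γ, where the ratio divides by zero, occurs only at weight q = 0.
    rcases hq.eq_or_lt with rfl | hq'
    · simp
    have hltop : l ≠ ∞ := by
      rintro rfl
      exact hl (ENNReal.mul_top (by simpa using hq'))
    have hy : 0 < betaPow β l := by
      rw [betaPow_coe_ennreal hltop]
      exact Real.rpow_pos_of_pos hβ _
    have hzpos : 0 < betaPow β z := by
      rw [hzx]
      have := mul_pos (sub_pos.2 ht1) hy
      have := mul_nonneg ht0.le (hnn x)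
      linarith
    obtain ⟨h1, h2⟩ := log_betaPow_le hβ hβ1 hlz hzpos
    refine ⟨ENNReal.mul_ne_top ENNReal.ofReal_ne_top h1, ?_⟩
    have h3 : 1 + t * (betaPow β x / betaPow β l - 1) = betaPow β z / betaPow β l := by
      rw [hzx]
      field_simp
      ring
    rw [h3, Real.log_div hzpos.ne' hy.ne', ENNReal.toReal_mul, ENNReal.toReal_mul,
      ENNReal.toReal_ofReal hq, betaPow_coe_ennreal hltop, Real.log_rpow hβ]
    have := mul_le_mul_of_nonneg_left h2 hq
    linarith
  obtain ⟨k0, k0'⟩ := key hp0 hf0 hz.1 hz₀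
  obtain ⟨k1, k1'⟩ := key hp1 hf1 hz.2 hz₁
  have hle := ENNReal.toReal_mono (ENNReal.add_ne_top.2 ⟨k0, k1⟩) (hγ γ')
  rw [expLoss, ENNReal.toReal_add hf0 hf1, ENNReal.toReal_add k0 k1] at hle
  have hlog := Real.log_neg hβ hβ1
  nlinarith

end Game

end Mixability

/-! ### Products of regret ratios and their growth. -/

section RegretRatio

/-- The inverse of the two-sided shift. -/
def unshiftZ (ω : ℤ → Bool) : ℤ → Bool := fun n => ω (n - 1)

theorem unshiftZ_shiftZ (ω : ℤ → Bool) : unshiftZ (shiftZ ω) = ω := by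
  ext n
  simp [unshiftZ, shiftZ]

theorem measurable_unshiftZ :
    Measurable[coordSpace (Set.Iio 0), coordSpace (Set.Iic 0)] unshiftZ := by
  refine measurable_comap_iff.2 ((@measurable_pi_iff _ _ _ (coordSpace (Set.Iio 0)) _ _).2
    fun i => measurable_coord (i := i - 1) ?_)
  have := i.2
  simp only [Set.mem_Iic, Set.mem_Iio] at this ⊢
  omega

/-- The last `n` outcomes before time `0`. -/
def wordBefore (n : ℕ) (ω : ℤ → Bool) : List Bool := List.ofFn fun i : Fin n => ω (i - n)

theorem wordBefore_iterate_shiftZ (n : ℕ) (ω : ℤ → Bool) :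
    wordBefore n (shiftZ^[n] ω) = pre (nonnegPart ω) n := by
  simp [wordBefore, pre, nonnegPart, iterate_shiftZ]

theorem measurable_comp_wordBefore {β : Type*} [MeasurableSpace β] (φ : List Bool → β) (n : ℕ) :
    Measurable[coordSpace (Set.Iio 0)] fun ω => φ (wordBefore n ω) := by
  have h : Measurable fun w : Fin n → Bool => φ (List.ofFn w) := measurable_of_finite _
  refine h.comp ((@measurable_pi_iff _ _ _ (coordSpace (Set.Iio 0)) _ _).2 fun i =>
    measurable_coord ?_)
  have := i.2
  simp only [Set.mem_Iio]
  omega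

variable (a : List Bool → Bool → ℝ) (y : Bool → (ℤ → Bool) → ℝ)

/-- The ratio of the exponentiated increment `a` of a superloss process (after a string of length
`n`) to the exponentiated loss `y` of a predictor knowing the infinite past, at time `0`. -/
noncomputable def regretRatio (n : ℕ) (b : Bool) (ω : ℤ → Bool) : ℝ≥0∞ :=
  ENNReal.ofReal (a (wordBefore n ω) b / y b ω)

/-- The product of the regret ratios over the `n` steps before time `0`. -/
noncomputable def regretProd : ℕ → (ℤ → Bool) → ℝ≥0∞
  | 0 => fun _ => 1
  | n + 1 => fun ω => regretProd n (unshiftZ ω) *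
      regretRatio a y n (unshiftZ ω 0) (unshiftZ ω)

variable {a y}

theorem regretProd_succ_iterate (n : ℕ) (ω : ℤ → Bool) :
    regretProd a y (n + 1) (shiftZ^[n + 1] ω) = regretProd a y n (shiftZ^[n] ω) *
      ENNReal.ofReal (a (pre (nonnegPart ω) n) (ω n) / y (ω n) (shiftZ^[n] ω)) := by
  simp only [regretProd]
  rw [Function.iterate_succ_apply', unshiftZ_shiftZ, regretRatio, wordBefore_iterate_shiftZ,
    iterate_shiftZ, zero_add]

theorem measurable_regretRatio (hy : ∀ b, Measurable[coordSpace (Set.Iio 0)] (y b))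
    (n : ℕ) (b : Bool) :
    Measurable[coordSpace (Set.Iio 0)] (regretRatio a y n b) :=
  ENNReal.measurable_ofReal.comp ((measurable_comp_wordBefore (fun x => a x b) n).div (hy b))

theorem measurable_regretProd (hy : ∀ b, Measurable[coordSpace (Set.Iio 0)] (y b)) (n : ℕ) :
    Measurable[coordSpace (Set.Iio 0)] (regretProd a y n) := by
  have hle : coordSpace (Set.Iio 0) ≤ coordSpace (Set.Iic 0) :=
    coordSpace_mono Set.Iio_subset_Iic_self
  induction n with
  | zero => exact measurable_const
  | succ n ih =>
    have h : Measurable[coordSpace (Set.Iic 0)] fun ω : ℤ → Bool =>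
        regretProd a y n ω * regretRatio a y n (ω 0) ω :=
      (ih.mono hle le_rfl).mul (measurable_bool_select
        (fun b => (measurable_regretRatio hy n b).mono hle le_rfl)
        (measurable_coord (Set.mem_Iic.2 le_rfl)))
    exact h.comp measurable_unshiftZ

variable {Q : Measure (ℤ → Bool)} [IsProbabilityMeasure Q]

/-- Supermartingale argument: one shift puts the newest factor at time 0, and given the past its
conditional mean is at most 1. Letting every product end just before time 0 makes the conditioning
σ-algebra the same for all n. -/
theorem lintegral_regretProd_le_one (hQ : MeasurePreserving shiftZ Q Q)
    (hy : ∀ b, Measurable[coordSpace (Set.Iio 0)] (y b)) (ha0 : ∀ x b, 0 ≤ a x b)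
    (hy0 : ∀ b ω, 0 ≤ y b ω)
    (hmean : ∀ x ω, condProbZero Q (Set.Iio 0) ω * (a x false / y false ω)
      + (1 - condProbZero Q (Set.Iio 0) ω) * (a x true / y true ω) ≤ 1) (n : ℕ) :
    ∫⁻ ω, regretProd a y n ω ∂Q ≤ 1 := by
  induction n with
  | zero => simp [regretProd]
  | succ n ih =>
    rw [← hQ.lintegral_comp ((measurable_regretProd hy _).mono (coordSpace_le _) le_rfl)]
    simp only [regretProd, unshiftZ_shiftZ]
    rw [lintegral_coord_zero (S := Set.Iio 0)
      (X := fun b ω => regretProd a y n ω * regretRatio a y n b ω)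
      fun b => (measurable_regretProd hy n).mul (measurable_regretRatio hy n b)]
    refine (lintegral_mono fun ω => ?_).trans ih
    set p := condProbZero Q (Set.Iio 0) ω with hp
    have hp0 : (0 : ℝ) ≤ p := p.2.1
    have hp1 : (0 : ℝ) ≤ 1 - p := by linarith [p.2.2]
    have hr (b : Bool) : 0 ≤ a (wordBefore n ω) b / y b ω := div_nonneg (ha0 _ _) (hy0 _ _)
    calc ENNReal.ofReal p * (regretProd a y n ω * regretRatio a y n false ω)
          + ENNReal.ofReal (1 - p) * (regretProd a y n ω * regretRatio a y n true ω)
        = regretProd a y n ω * (ENNReal.ofReal p * regretRatio a y n false ω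
          + ENNReal.ofReal (1 - p) * regretRatio a y n true ω) := by ring
      _ ≤ regretProd a y n ω * 1 := by
        gcongr
        rw [regretRatio, regretRatio, ← ENNReal.ofReal_mul hp0, ← ENNReal.ofReal_mul hp1,
          ← ENNReal.ofReal_add (mul_nonneg hp0 (hr _)) (mul_nonneg hp1 (hr _))]
        exact ENNReal.ofReal_le_one.2 (hmean _ ω)
      _ = regretProd a y n ω := mul_one _

/-- Nonnegative functions with means at most `1` almost surely grow at most quadratically. -/
theorem ae_eventually_le_sq {Ω : Type*} [MeasurableSpace Ω] {μ : Measure Ω} {M : ℕ → Ω → ℝ≥0∞}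
    (hM : ∀ n, Measurable (M n)) (hint : ∀ n, ∫⁻ ω, M n ω ∂μ ≤ 1) :
    ∀ᵐ ω ∂μ, ∀ᶠ n : ℕ in atTop, M n ω ≤ ENNReal.ofReal (((n : ℝ) + 1) ^ 2) := by
  set w : ℕ → ℝ := fun n => ((n : ℝ) + 1) ^ 2
  have hw (n : ℕ) : 0 < w n := by positivity
  have hsum : Summable fun n => (w n)⁻¹ := by
    have := (summable_nat_add_iff 1).2 (Real.summable_nat_pow_inv.2 (one_lt_two))
    simpa [w] using this
  -- The weights 1/(n+1)^2 are summable, so the weighted series has finite mean and its terms tend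
  -- to 0 almost surely.
  have hfin : ∫⁻ ω, ∑' n, ENNReal.ofReal (w n)⁻¹ * M n ω ∂μ ≠ ∞ := by
    rw [lintegral_tsum fun n => ((hM n).const_mul _).aemeasurable]
    refine ne_top_of_le_ne_top (b := ∑' n, ENNReal.ofReal (w n)⁻¹) ?_
      (ENNReal.tsum_le_tsum fun n => ?_)
    · rw [← ENNReal.ofReal_tsum_of_nonneg (fun n => (inv_pos.2 (hw n)).le) hsum]
      exact ENNReal.ofReal_ne_top
    · rw [lintegral_const_mul _ (hM n)]
      exact mul_le_of_le_one_right' (hint n)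
  have hae := ae_lt_top (Measurable.tsum fun n => (hM n).const_mul _) hfin
  filter_upwards [hae] with ω hω
  have h0 := ENNReal.tendsto_atTop_zero_of_tsum_ne_top hω.ne
  filter_upwards [h0.eventually (gt_mem_nhds one_pos)] with n hn
  have hwn : ENNReal.ofReal (w n) ≠ 0 := by simpa using hw n
  rw [ENNReal.ofReal_inv_of_pos (hw n)] at hn
  rw [← one_mul (ENNReal.ofReal _)]
  rw [mul_comm, ← div_eq_mul_inv] at hn
  exact (ENNReal.div_le_iff hwn ENNReal.ofReal_ne_top).1 hn.le

end RegretRatio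

/-! ### Pathwise regret bounds. -/

namespace Game

variable {G : Game} {s : I → I} {Q : Measure (ℤ → Bool)} [IsProbabilityMeasure Q]

/-- The almost sure quadratic bound for the exponentiated regret of a superloss process with
respect to the optimal predictor that knows the infinite past. -/
theorem ae_eventually_le_sq_of_isMixable (hG : G.IsRegular) (hQ : MeasurePreserving shiftZ Q Q)
    (hs : Continuous s) (hmin : ∀ p γ : I, G.expLoss p (s p) ≤ G.expLoss p γ) {β : ℝ} (hβ : 0 < β)
    (hβ1 : β < 1)
    (hconv : Convex ℝ ((fun p : EReal × EReal => (betaPow β p.1, betaPow β p.2)) '' G.superscores))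
    {c : List Bool → EReal × EReal} (hc : ∀ x, c x ∈ G.superscores) :
    ∀ᵐ ω ∂Q, ∀ᶠ n : ℕ in atTop,
      ∏ i ∈ Finset.range n, ENNReal.ofReal
        (betaPow β (bif ω i then (c (pre (nonnegPart ω) i)).2 else (c (pre (nonnegPart ω) i)).1)
          / betaPow β (G.lossAtZero s Q (Set.Iio 0) (shiftZ^[i] ω)))
        ≤ ENNReal.ofReal (((n : ℝ) + 1) ^ 2) := by
  set a : List Bool → Bool → ℝ := fun x b => betaPow β (bif b then (c x).2 else (c x).1)
  set y : Bool → (ℤ → Bool) → ℝ :=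
    fun b ω => betaPow β (G.loss b (s (condProbZero Q (Set.Iio 0) ω)))
  have hy (b : Bool) : Measurable[coordSpace (Set.Iio 0)] (y b) :=
    (measurable_betaPow.comp (measurable_coe_ennreal_ereal.comp
      ((hG.continuous b).measurable.comp hs.measurable))).comp measurable_condProbZero
  have hfin (p : I) : G.expLoss p (s p) ≠ ∞ := by
    obtain ⟨γ, hγ⟩ := hG.exists_finite
    exact ne_top_of_le_ne_top (ENNReal.add_ne_top.2 ⟨(hγ false).ne, (hγ true).ne⟩)
      ((hmin p γ).trans (expLoss_le p γ))
  have hint := lintegral_regretProd_le_one (a := a) hQ hy (fun _ _ => betaPow_nonneg hβ _)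
    (fun _ _ => betaPow_nonneg hβ _)
    fun x ω => mean_betaPow_div_le_one hβ hβ1 hconv (hmin _) (hfin _) (hc x)
  have hm (n : ℕ) : Measurable (regretProd a y n) :=
    (measurable_regretProd hy n).mono (coordSpace_le _) le_rfl
  -- Shifting by n carries the product over times -n, …, -1 to the times 0, …, n - 1, without
  -- changing its mean.
  have hae := ae_eventually_le_sq (μ := Q) (M := fun n ω => regretProd a y n (shiftZ^[n] ω))
    (fun n => (hm n).comp (hQ.iterate n).measurable)
    (fun n => ((hQ.iterate n).lintegral_comp (hm n)).trans_le (hint n))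
  filter_upwards [hae] with ω hω
  filter_upwards [hω] with n hn
  refine le_trans (le_of_eq ?_) hn
  clear hn
  induction n with
  | zero => simp [regretProd]
  | succ n ih =>
    rw [Finset.prod_range_succ, ih, regretProd_succ_iterate]
    simp [a, y, lossAtZero, iterate_shiftZ]

/-- Along a sequence with finite losses `g i`, a superloss process is infinite or its regret is
given by the product of the regret ratios. -/
theorem eq_top_or_prod_eq {K : List Bool → EReal} (hnil : K [] = 0) {β : ℝ} (hβ : 0 < β)
    {c : List Bool → EReal × EReal} (hc : ∀ x, c x ∈ G.superscores)
    (hinc : ∀ x, K (x ++ [false]) = K x + (c x).1 ∧ K (x ++ [true]) = K x + (c x).2)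
    (η : ℕ → Bool) {g : ℕ → ℝ≥0∞} (hg : ∀ i, g i ≠ ∞) (n : ℕ) :
    K (pre η n) = ⊤ ∨ ∃ r : ℝ, K (pre η n) = r ∧
      ∏ i ∈ Finset.range n, ENNReal.ofReal
        (betaPow β (bif η i then (c (pre η i)).2 else (c (pre η i)).1) / betaPow β (g i))
        = ENNReal.ofReal (β ^ (r - ∑ i ∈ Finset.range n, (g i).toReal)) := by
  induction n with
  | zero => exact Or.inr ⟨0, by simp [pre, hnil], by simp⟩
  | succ n ih =>
    set v : EReal := bif η n then (c (pre η n)).2 else (c (pre η n)).1 with hv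
    have hK : K (pre η (n + 1)) = K (pre η n) + v := by
      rw [pre_succ, hv]
      cases η n
      · exact (hinc _).1
      · exact (hinc _).2
    have hvbot : v ≠ ⊥ := by
      rw [hv]
      cases η n
      · exact (hc _).1
      · exact (hc _).2.1
    rcases ih with h | ⟨r, hr, hprod⟩
    · left
      rw [hK, h, EReal.top_add_of_ne_bot hvbot]
    · induction hv' : v with
      | bot => exact absurd hv' hvbot
      | top => exact Or.inl (by rw [hK, hr, hv', EReal.coe_add_top])
      | coe t =>
        refine Or.inr ⟨r + t, by rw [hK, hr, hv', EReal.coe_add], ?_⟩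
        rw [Finset.prod_range_succ, hprod, ← hv, hv', Finset.sum_range_succ, betaPow_coe,
          betaPow_coe_ennreal (hg n), ← Real.rpow_sub hβ,
          ← ENNReal.ofReal_mul (Real.rpow_nonneg hβ.le _), ← Real.rpow_add hβ]
        congr 2
        ring

end Game

/-! ### The lower bound for superloss processes. -/

namespace Game

variable {G : Game} {P : Measure (ℕ → Bool)} [IsProbabilityMeasure P]

theorem le_of_rpow_le_sq {β : ℝ} (hβ : 0 < β) (hβ1 : β < 1) {d x : ℝ}
    (h : β ^ d ≤ x ^ 2) : 2 * Real.log x / Real.log β ≤ d := by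
  have h1 := Real.log_le_log (Real.rpow_pos_of_pos hβ d) h
  rw [Real.log_rpow hβ, Real.log_pow] at h1
  rw [div_le_iff_of_neg (Real.log_neg hβ hβ1)]
  exact_mod_cast h1

theorem tendsto_log_add_one_div :
    Tendsto (fun n : ℕ => Real.log ((n : ℝ) + 1) / n) atTop (𝓝 0) := by
  have h1 : Tendsto (fun x : ℝ => Real.log x / x) atTop (𝓝 0) := by
    simpa using Real.tendsto_pow_log_div_mul_add_atTop 1 0 1 one_ne_zero
  have h2 : Tendsto (fun n : ℕ => (n : ℝ) + 1) atTop atTop :=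
    tendsto_atTop_add_const_right _ _ tendsto_natCast_atTop_atTop
  have h3 : Tendsto (fun n : ℕ => ((n : ℝ) + 1) / n) atTop (𝓝 1) := by
    have := (tendsto_const_nhds (x := (1 : ℝ))).add (tendsto_const_div_atTop_nhds_zero_nat (1 : ℝ))
    rw [add_zero] at this
    refine this.congr' ?_
    filter_upwards [eventually_gt_atTop 0] with n hn
    have : (n : ℝ) ≠ 0 := by exact_mod_cast hn.ne'
    field_simp
  have h4 := (h1.comp h2).mul h3
  rw [zero_mul] at h4
  refine h4.congr' ?_
  filter_upwards [eventually_gt_atTop 0] with n hn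
  have : (n : ℝ) ≠ 0 := by exact_mod_cast hn.ne'
  have : (n : ℝ) + 1 ≠ 0 := by positivity
  simp only [Function.comp_apply]
  field_simp

/-- The quadratic bound on β^(K - ∑ g∘T^i) becomes, after logarithms, K ≥ ∑ g∘T^i + 2 log(n+1)/log β
with log β < 0; the correction vanishes on division by n. -/
theorem IsSuperloss.ae_eventually_le_div {K : List Bool → EReal} (hK : G.IsSuperloss K)
    (hP : Ergodic shift P) (hG : G.IsStronglyRegular P) (hmix : G.IsMixable) {v : ℝ}
    (hv : v < (⨅ k, G.stepEntropy P k).toReal) :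
    ∀ᵐ η ∂P, ∀ᶠ n : ℕ in atTop, (v : EReal) ≤ K (pre η n) / (n : EReal) := by
  obtain ⟨hreg, s, hs, hmin, Q, hQ, -⟩ := hG
  obtain ⟨β, hβ, hβ1, hconv⟩ := hmix
  have hprob := hQ.isProbabilityMeasure
  have herg := hQ.ergodic hP
  set g := G.lossAtZero s Q (Set.Iio 0) with hg
  have hgm : Measurable g := hreg.measurable_lossAtZero hs _
  have hgfin : ∫⁻ ω, g ω ∂Q ≠ ∞ := hreg.lintegral_lossAtZero_ne_top hs hmin _
  have hmean : v < ∫ ω, (g ω).toReal ∂Q := by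
    rw [integral_toReal hgm.aemeasurable (ae_lt_top hgm hgfin)]
    exact hv.trans_le (ENNReal.toReal_mono hgfin (hreg.iInf_stepEntropy_le hQ hs hmin))
  have hbirk := ae_tendsto_birkhoffSum_div herg hgm.ennreal_toReal
    (integrable_toReal_of_lintegral_ne_top hgm.aemeasurable hgfin)
  choose c hc hinc using hK.increments
  have hsq := ae_eventually_le_sq_of_isMixable hreg hQ.invariant hs hmin hβ hβ1 hconv hc
  have hgi : ∀ᵐ ω ∂Q, ∀ i : ℕ, g (shiftZ^[i] ω) < ∞ := ae_all_iff.2 fun i =>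
    (hQ.invariant.iterate i).quasiMeasurePreserving.ae (ae_lt_top hgm hgfin)
  -- Measurability lets the almost sure statement be proved under Q and pushed forward to P.
  have hmeas : MeasurableSet {η | ∀ᶠ n : ℕ in atTop, (v : EReal) ≤ K (pre η n) / (n : EReal)} := by
    simp only [eventually_atTop, Set.ofPred_exists, Set.ofPred_forall]
    exact .iUnion fun N => .iInter fun n => .iInter fun _ =>
      measurableSet_setOfPred.2 (measurable_comp_pre (fun x => (v : EReal) ≤ K x / (n : EReal)) n)
  rw [← hQ.map_nonnegPart, ae_map_iff measurable_nonnegPart.aemeasurable hmeas]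
  filter_upwards [hbirk, hsq, hgi] with ω h1 h2 h3
  have h4 : Tendsto (fun n : ℕ => birkhoffSum shiftZ (fun ω => (g ω).toReal) n ω / n
      + 2 / Real.log β * (Real.log ((n : ℝ) + 1) / n)) atTop (𝓝 (∫ ω, (g ω).toReal ∂Q)) := by
    simpa using h1.add (tendsto_log_add_one_div.const_mul (2 / Real.log β))
  filter_upwards [h2, h4.eventually (lt_mem_nhds hmean), eventually_gt_atTop 0] with n h5 h6 hn
  have hn' : (0 : ℝ) < n := by exact_mod_cast hn
  rcases eq_top_or_prod_eq hK.nil hβ hc hinc (nonnegPart ω) (fun i => (h3 i).ne) n with h7 | h7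
  · rw [h7, EReal.top_div_of_pos_ne_top (by exact_mod_cast hn) (EReal.natCast_ne_top n)]
    exact le_top
  · obtain ⟨r, hr, hprod⟩ := h7
    rw [hr, ← EReal.coe_natCast, ← EReal.coe_div, EReal.coe_le_coe_iff]
    have h8 := hprod.symm.trans_le h5
    rw [ENNReal.ofReal_le_ofReal_iff (by positivity)] at h8
    have h9 := le_of_rpow_le_sq hβ hβ1 h8
    have h10 : birkhoffSum shiftZ (fun ω => (g ω).toReal) n ω
        = ∑ i ∈ Finset.range n, (g (shiftZ^[i] ω)).toReal := rfl
    refine h6.le.trans ?_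
    rw [h10, ← mul_div_assoc, ← add_div, div_le_div_iff_of_pos_right hn']
    have h11 : 2 * Real.log ((n : ℝ) + 1) / Real.log β
      = 2 / Real.log β * Real.log ((n : ℝ) + 1) := by ring
    linarith

end Game

/-! ### Combination of the two bounds. -/

theorem theorem6p2 (G : Game) (P : Measure (ℕ → Bool)) [IsProbabilityMeasure P]
    (hP : Ergodic shift P) (hG : G.IsStronglyRegular P) (hmix : G.IsMixable)
    (K : List Bool → EReal) (hK : G.IsPredictiveComplexity K) :
    Tendsto (fun n : ℕ => G.nStepEntropy P n / n) atTop (𝓝 (G.generalizedEntropy P)) ∧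
    G.generalizedEntropy P ≠ ∞ ∧
    ∀ᵐ ω ∂P, Tendsto (fun n : ℕ => K (pre ω n) / (n : EReal)) atTop
      (𝓝 ((G.generalizedEntropy P : ℝ≥0∞) : EReal)) := by
  have hreg := hG.1
  have hmp := hP.toMeasurePreserving
  rw [Game.generalizedEntropy_eq hreg hmp]
  have hfin : ⨅ k, G.stepEntropy P k ≠ ∞ :=
    ne_top_of_le_ne_top (Game.stepEntropy_ne_top hreg 0) (iInf_le _ 0)
  refine ⟨Game.tendsto_nStepEntropy_div hreg hmp, hfin, ?_⟩
  have hpos (j : ℕ) : (0 : ℝ) < 1 / ((j : ℝ) + 1) := Nat.one_div_pos_of_nat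
  -- Only countably many margins 1/(j+1) and memory lengths k are used, so one null set serves for
  -- all.
  have hlow := ae_all_iff.2 fun j : ℕ => hK.1.ae_eventually_le_div hP hG hmix
    (v := (⨅ k, G.stepEntropy P k).toReal - 1 / ((j : ℝ) + 1)) (by linarith [hpos j])
  have hupp := ae_all_iff.2 fun k : ℕ => ae_all_iff.2 fun j : ℕ =>
    hK.ae_eventually_div_le hreg hP k (hpos j)
  filter_upwards [hlow, hupp] with ω h1 h2
  rw [← EReal.coe_ennreal_toReal hfin, tendsto_order]
  constructor
  · intro a ha
    obtain ⟨r, har, hr⟩ := EReal.lt_iff_exists_real_btwn.1 ha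
    rw [EReal.coe_lt_coe_iff] at hr
    obtain ⟨j, hj⟩ := exists_nat_one_div_lt (sub_pos.2 hr)
    filter_upwards [h1 j] with n hn
    exact (har.trans (EReal.coe_lt_coe_iff.2 (by linarith))).trans_le hn
  · intro a ha
    obtain ⟨r, hr, hra⟩ := EReal.lt_iff_exists_real_btwn.1 ha
    rw [EReal.coe_lt_coe_iff] at hr
    -- Half of the gap r - h absorbs the margin 1/(j+1), the other half the excess of h_k over h.
    obtain ⟨j, hj⟩ := exists_nat_one_div_lt (half_pos (sub_pos.2 hr))
    have hlim := (ENNReal.tendsto_toReal hfin).comp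
      (tendsto_atTop_iInf (Game.stepEntropy_antitone (G := G) hmp))
    obtain ⟨k, hk⟩ := (hlim.eventually (gt_mem_nhds (left_lt_add_div_two.2 hr))).exists
    simp only [Function.comp_apply] at hk
    filter_upwards [h2 k j] with n hn
    exact hn.trans_lt ((EReal.coe_lt_coe_iff.2 (by linarith)).trans hra)
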